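/- Throughout, $\kappa$ is an \emph{arity class}: a class of small cardinals with $1\in\kappa$ that is closed under indexed sums ($|I|\in\kappa$ and all $\alpha_i\in\kappa$ imply $\sum_{i\in I}\alpha_i\in\kappa$) and indexed decompositions ($|I|\in\kappa$ and $\sum_{i\in I}\alpha_i\in\kappa$ imply all $\alpha_i\in\kappa$). A family is $\kappa$-ary if its index set has cardinality in $\kappa$. A \emph{functional array} $F:X\Rightarrow Y$ of $\kappa$-ary families in a category consists of a function $f$ from the indices of $X$ to those of $Y$ and morphisms $f_x:x\to f(x)$; a cocone $F:X\Rightarrow y$ is the case of a single target. \textbf{Sites.} A \emph{weakly $\kappa$-ary topology} on a category $C$ specifies covering families $P:V\Rightarrow u$ that are $\kappa$-ary cocones, such that identities are covering; covering families compose; for $P:V\Rightarrow u$ covering and $f:x\to u$ there is a covering $Q$ of $x$ such that $fQ$ factors through $P$; and a $\kappa$-ary cocone through which a covering family factors is covering. A functional array $P:V\Rightarrow U$ is covering if each of its restrictions $P|_u:V|_u\Rightarrow u$ is. A \emph{$\kappa$-ary site} is a category with a weakly $\kappa$-ary topology such that every finite diagram $g$ has a \emph{local $\kappa$-prelimit}: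 a $\kappa$-ary family of cones over $g$ such that every cone over $g$ with vertex $s$, after restriction along the members of some covering family of $s$, factors through members of the family. For $\kappa$-ary families $P,Q$ of spans $x\leftarrow\cdot\to y$ (arrays over $\{x,y\}$), $P\le Q$ means that every span of $P$ factors through some span of $Q$, and $P\lesssim Q$ ($P$ \emph{locally refines} $Q$) means $PR\le Q$ for some covering family $R$ of the domain of $P$. Arrays over $\{x,y\}$ and $\{y,z\}$ have a composite $P\times_yQ$, arrays over $\{x,y\}$ have a binary meet, and an array $P$ over $\{x,y\}$ has a pullback along a pair $v\to x$, $v'\to y$; these are formed from local $\kappa$-prelimits of the evident finite diagrams and are well defined up to local refinement in both directions. A \emph{$\kappa$-ary congruence} $\Phi$ on a $\kappa$-ary family $X$ in the site consists of arrays $\Phi(i,j)$ over $\{x_i,x_j\}$ with $\{1,1\}\lesssim\Phi(i,i)$, $\Phi(i,j)^{\circ}\lesssim\Phi(j,i)$ and $\Phi(i,j)\times_{x_j}\Phi(j,k)\lesssim\Phi(i,k)$, where $(-)^\circ$ exchanges the legs; $F^*\Phi$ is its pullback along a functional array $F$. \textbf{Allegories.} A \emph{$\kappa$-ary allegory} $\mathcal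 A$ is a category enriched in posets with binary meets and $\kappa$-ary joins, where composition and binary meets preserve $\kappa$-ary joins, together with an identity-on-objects, order-preserving contravariant involution $(-)^\circ$, satisfying the modular law $\psi\varphi\wedge\chi\le(\psi\wedge\chi\varphi^\circ)\varphi$. A \emph{map} is a morphism with a right adjoint, which is then $\varphi^\circ$; maps form a category $\mathrm{Map}(\mathcal A)$. A $\kappa$-ary congruence in $\mathcal A$ on a $\kappa$-ary family $X$ is an array of morphisms $\Phi(i,j):x_i\to x_j$ with $1\le\Phi(i,i)$, $\Phi(i,j)^\circ\le\Phi(j,i)$ and $\Phi(j,k)\Phi(i,j)\le\Phi(i,k)$. The congruences are the objects of a $\kappa$-ary allegory $\mathrm{Mod}_\kappa(\mathcal A)$, whose morphisms $\Phi\to\Theta$ are the arrays $\Psi$ of morphisms of $\mathcal A$ with $\bigvee\Psi\Phi\le\Psi$ and $\bigvee\Theta\Psi\le\Psi$; composition is $\bigvee\Psi'\Psi$, the identity of $\Phi$ is $\Phi$, and order, meets, joins and involution are pointwise. A \emph{framed $\kappa$-ary allegory} $\mathbb A$ is a $\kappa$-ary allegory $\mathcal A$ with a category $\mathrm{TMap}(\mathbb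 A)$ of \emph{tight maps} and a functor $(-)_\bullet:\mathrm{TMap}(\mathbb A)\to\mathrm{Map}(\mathcal A)$ that is the identity on objects; put $f^\bullet=(f_\bullet)^\circ$. A tight map $f$ is a \emph{weak equivalence} ($f\in\mathcal W$) if $f_\bullet$ is invertible. A $\kappa$-ary cocone $P:V\Rightarrow u$ of tight maps is \emph{covering} if $\bigvee P_\bullet P^\bullet=1_u$, and a functional array of tight maps is covering if its restriction over each target is. $\mathbb A$ is \emph{weakly $\kappa$-tabular} if every morphism of $\mathcal A$ is $\bigvee F_\bullet G^\bullet$ for $\kappa$-ary cocones $F,G$ of tight maps with a common source family, and if for tight $f,g$ with $f_\bullet=g_\bullet$ there is a covering $P$ with $fP=gP$. A \emph{collage} of a congruence $\Phi$ on $X$ is a cocone $\Psi:X\Rightarrow z$ in $\mathcal A$ with $\bigvee\Psi\Phi\le\Psi$ such that composition with $\Psi$ is, for each $t$, an isomorphism of posets from $\mathcal A(z,t)$ onto the set of cocones $\Theta:X\Rightarrow t$ with $\bigvee\Theta\Phi\le\Theta$; a \emph{tight collage} is a cocone $F:X\Rightarrow z$ of tight maps such that $F_\bullet$ is a collage and,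 for every $\chi:z\to t$ in $\mathcal A$, composition with $F$ is a bijection from the tight $h:z\to t$ with $h_\bullet=\chi$ to the tight cocones $G:X\Rightarrow t$ with $G_\bullet=\chi F_\bullet$. For a $\kappa$-ary site $C$, $\mathrm{Rel}_\kappa(C)$ is the following framed $\kappa$-ary allegory. Its objects are those of $C$; its hom-poset from $x$ to $y$ is the poset reflection of the arrays over $\{x,y\}$ under $\lesssim$; composition is $\times_y$, meets are as above, joins are disjoint unions and the involution exchanges the legs; its tight maps are the morphisms of $C$, and $f_\bullet$ is the class of $\{1_x,f\}$. The \emph{$\kappa$-ary exact completion} of $C$ is $\mathrm{Ex}_\kappa(C)=\mathrm{Map}(\mathrm{Mod}_\kappa(\mathrm{Rel}_\kappa(C)))$. \textbf{Theorem.} (A) Let $\mathbb A$ be a weakly $\kappa$-tabular framed $\kappa$-ary allegory in which every $\kappa$-ary congruence has a tight collage. Then the weak equivalences $\mathcal W$ in $\mathrm{TMap}(\mathbb A)$ admit a calculus of right fractions, and $(-)_\bullet$ induces an isomorphism of categories $\mathrm{TMap}(\mathbb A)[\mathcal W^{-1}]\cong\mathrm{Map}(\mathcal A)$. (B) Let $\mathbb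 A$ be a weakly $\kappa$-tabular framed $\kappa$-ary allegory. The objects of $\mathrm{Map}(\mathrm{Mod}_\kappa(\mathcal A))$ are the $\kappa$-ary congruences in $\mathcal A$. For congruences $\Phi$ on $X$ and $\Theta$ on $Y$, consider spans $X\overset{P}{\Leftarrow}W\overset{F}{\Rightarrow}Y$ of functional arrays of tight maps, with $W$ a $\kappa$-ary family, $P$ covering and $P^\bullet\Phi P_\bullet\le F^\bullet\Theta F_\bullet$. For each such span the map $P_\blacklozenge=\Phi P_\bullet:P^\bullet\Phi P_\bullet\to\Phi$ is invertible in $\mathrm{Map}(\mathrm{Mod}_\kappa(\mathcal A))$; the span \emph{represents} the unique $m:\Phi\to\Theta$ with $mP_\blacklozenge=F_\blacklozenge$, where $F_\blacklozenge=\Theta F_\bullet:P^\bullet\Phi P_\bullet\to\Theta$. Every morphism $\Phi\to\Theta$ is represented by such a span. Two such spans $(P,F)$ on $W$ and $(P',F')$ on $W'$ represent the same morphism if and only if there are a $\kappa$-ary family $U$ and functional arrays of tight maps $S:U\Rightarrow W$, $S':U\Rightarrow W'$ such that $PS=P'S'$ is a covering family of $X$ and $\bigvee (FS)_\bullet(F'S')^\bullet\le\Theta$.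 (C) Let $C$ be a $\kappa$-ary site. Then $\mathrm{Ex}_\kappa(C)$ is described as follows. (i) Its objects are the $\kappa$-ary congruences in $C$: passing to classes of arrays maps the congruences on $X$ in $C$ onto the congruences on $X$ in $\mathrm{Rel}_\kappa(C)$, and $\Phi,\Phi'$ on the same family $X$ have the same image if and only if $\Phi(i,j)\lesssim\Phi'(i,j)$ and $\Phi'(i,j)\lesssim\Phi(i,j)$ for all $i,j$. (ii) For congruences $\Phi$ on $X$ and $\Psi$ on $Y$, every morphism $\Phi\to\Psi$ is represented by a span $X\overset{P}{\Leftarrow}W\overset{F}{\Rightarrow}Y$ of functional arrays in $C$, with $W$ a $\kappa$-ary family, $P$ a covering family and $P^*\Phi\lesssim F^*\Psi$ (entrywise); conversely, for each such span the map $P_\blacklozenge:P^*\Phi\to\Phi$ is invertible in $\mathrm{Ex}_\kappa(C)$, so that the span represents exactly one morphism $m$, namely the one with $mP_\blacklozenge=F_\blacklozenge$. (iii) Two such spans $(P,F)$ and $(Q,G)$, with apexes $W$ and $W'$, represent the same morphism $\Phi\to\Psi$ if and only if there are a $\kappa$-ary covering family $R:U\Rightarrow X$ and functional arrays $H:U\Rightarrow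 W$, $K:U\Rightarrow W'$ such that $R=PH=QK$ and, for all $u\in U$, $\{f_{h(u)}h_u,\;g_{k(u)}k_u\}\le\Psi(fh(u),gk(u))$; that is, this span factors through one of the spans in the array $\Psi(fh(u),gk(u))$. -/

import Mathlib

open CategoryTheory CategoryTheory.Limits Cardinal

universe w u v v'

namespace ExactCompletion

/-! ## Arity classes, families, functional arrays -/

/-- An arity class: a class of small cardinals (here: cardinals of types in universe `w`)
containing `1` and closed under indexed sums and indexed decompositions. -/
structure ArityClass where
  carrier : Set Cardinal.{w}
  one_mem : 1 ∈ carrier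
  sum_mem : ∀ {I : Type w} (α : I → Cardinal.{w}), #I ∈ carrier → (∀ i, α i ∈ carrier) →
    Cardinal.sum α ∈ carrier
  mem_of_sum_mem : ∀ {I : Type w} (α : I → Cardinal.{w}), #I ∈ carrier →
    Cardinal.sum α ∈ carrier → ∀ i, α i ∈ carrier

/-- A (small) set is `κ`-small if its cardinality belongs to `κ`. -/
def ArityClass.IsSmall (κ : ArityClass.{w}) (I : Type w) : Prop := #I ∈ κ.carrier

namespace ArityClass

variable {κ : ArityClass.{w}}

theorem isSmall_of_equiv {I J : Type w} (e : I ≃ J) (h : κ.IsSmall I) : κ.IsSmall J := by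
  unfold IsSmall at *
  rwa [← Cardinal.mk_congr e]

theorem isSmall_punit : κ.IsSmall PUnit.{w + 1} := by
  unfold IsSmall
  simpa using κ.one_mem

theorem isSmall_sigma {I : Type w} {J : I → Type w} (hI : κ.IsSmall I)
    (hJ : ∀ i, κ.IsSmall (J i)) : κ.IsSmall (Σ i, J i) := by
  unfold IsSmall at *
  rw [Cardinal.mk_sigma]
  exact κ.sum_mem _ hI hJ

theorem isSmall_prod {I J : Type w} (hI : κ.IsSmall I) (hJ : κ.IsSmall J) :
    κ.IsSmall (I × J) :=
  isSmall_of_equiv (Equiv.sigmaEquivProd I J) (isSmall_sigma hI fun _ => hJ)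

theorem isSmall_fiber {I J : Type w} (f : I → J) (hI : κ.IsSmall I) (hJ : κ.IsSmall J) (j : J) :
    κ.IsSmall {i // f i = j} := by
  refine κ.mem_of_sum_mem (fun j => #{i // f i = j}) hJ ?_ j
  rw [← Cardinal.mk_sigma, Cardinal.mk_congr (Equiv.sigmaFiberEquiv f)]
  exact hI

end ArityClass

/-- A `κ`-ary family of objects of `C`. -/
structure Fam (κ : ArityClass.{w}) (C : Type u) where
  ι : Type w
  small : κ.IsSmall ι
  obj : ι → C

section Arrays

variable {κ : ArityClass.{w}} {C : Type u} [Category.{v} C]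

/-- A functional array `X ⇒ Y`. -/
structure FunArr (X Y : Fam κ C) where
  toFun : X.ι → Y.ι
  hom : ∀ i, X.obj i ⟶ Y.obj (toFun i)

/-- Composition of functional arrays, in diagrammatic order. -/
def FunArr.comp {X Y Z : Fam κ C} (F : FunArr X Y) (G : FunArr Y Z) : FunArr X Z where
  toFun i := G.toFun (F.toFun i)
  hom i := F.hom i ≫ G.hom (F.toFun i)

/-- A small cocone over `u`: a small family of morphisms with common target `u`. -/
structure Sink (C : Type u) [Category.{v} C] (u : C) where
  ι : Type w
  obj : ι → C
  map : ∀ i, obj i ⟶ u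

/-- `P` refines (factors through) `Q`. -/
def Sink.Refines {u : C} (P Q : Sink.{w} C u) : Prop :=
  ∀ i, ∃ (j : Q.ι) (h : P.obj i ⟶ Q.obj j), h ≫ Q.map j = P.map i

/-- The cocone consisting of the identity of `u` alone. -/
def Sink.single (u : C) : Sink.{w} C u where
  ι := PUnit
  obj _ := u
  map _ := 𝟙 u

/-- The cocone `f P`. -/
def Sink.push {x u : C} (P : Sink.{w} C x) (f : x ⟶ u) : Sink.{w} C u where
  ι := P.ι
  obj := P.obj
  map i := P.map i ≫ f

/-- The cocone `P (⨆ Q_v)`. -/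
def Sink.bind {u : C} (P : Sink.{w} C u) (Q : ∀ i, Sink.{w} C (P.obj i)) : Sink.{w} C u where
  ι := Σ i, (Q i).ι
  obj k := (Q k.1).obj k.2
  map k := (Q k.1).map k.2 ≫ P.map k.1

/-- The cocone `F|_y : X|_y ⇒ y` obtained from a functional array `F : X ⇒ Y`. -/
def FunArr.fiber {X Y : Fam κ C} (F : FunArr X Y) (y : Y.ι) : Sink.{w} C (Y.obj y) where
  ι := {i : X.ι // F.toFun i = y}
  obj i := X.obj i.1
  map i := F.hom i.1 ≫ eqToHom (congrArg Y.obj i.2)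

end Arrays

/-! ## Sites -/

/-- A weakly `κ`-ary topology. -/
structure WeakTopology (κ : ArityClass.{w}) (C : Type u) [Category.{v} C] where
  Covers : ∀ {u : C}, Sink.{w} C u → Prop
  small : ∀ {u : C} {P : Sink.{w} C u}, Covers P → κ.IsSmall P.ι
  single : ∀ u : C, Covers (Sink.single.{w} u)
  pullback : ∀ {u : C} {P : Sink.{w} C u}, Covers P → ∀ {x : C} (f : x ⟶ u),
    ∃ Q : Sink.{w} C x, Covers Q ∧ (Q.push f).Refines P
  bind : ∀ {u : C} {P : Sink.{w} C u}, Covers P → ∀ Q : ∀ i, Sink.{w} C (P.obj i),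
    (∀ i, Covers (Q i)) → Covers (P.bind Q)
  saturated : ∀ {u : C} {P Q : Sink.{w} C u}, Covers P → κ.IsSmall Q.ι → P.Refines Q → Covers Q

/-- A local `κ`-prelimit of `g : D ⥤ C`: a `κ`-small family of cones over `g` through which every
cone over `g` factors locally. -/
structure LocalPrelimit {κ : ArityClass.{w}} {C : Type u} [Category.{v} C] (S : WeakTopology κ C)
    {D : Type} [SmallCategory D] (g : D ⥤ C) where
  ι : Type w
  small : κ.IsSmall ι
  cone : ι → Cone g
  factors : ∀ s : Cone g, ∃ P : Sink.{w} C s.pt, S.Covers P ∧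
    ∀ p, ∃ (i : ι) (h : P.obj p ⟶ (cone i).pt),
      ∀ d : D, h ≫ (cone i).π.app d = P.map p ≫ s.π.app d

/-- A `κ`-ary topology: a weakly `κ`-ary topology such that all finite diagrams have
local `κ`-prelimits. -/
structure Topology (κ : ArityClass.{w}) (C : Type u) [Category.{v} C] extends
    WeakTopology κ C where
  exists_prelimit : ∀ (D : Type) [SmallCategory D] [FinCategory D] (g : D ⥤ C),
    Nonempty (LocalPrelimit toWeakTopology g)

/-- A covering family of a family of objects. -/
def WeakTopology.IsCovering {κ : ArityClass.{w}} {C : Type u} [Category.{v} C]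
    (S : WeakTopology κ C) {V U : Fam κ C} (P : FunArr V U) : Prop :=
  ∀ i, S.Covers (P.fiber i)

/-! ## Arrays over a pair of objects -/

/-- A `κ`-sourced array over the two-element family `{x, y}`. -/
structure SpanArr (κ : ArityClass.{w}) {C : Type u} [Category.{v} C] (x y : C) where
  dom : Fam κ C
  fst : ∀ i, dom.obj i ⟶ x
  snd : ∀ i, dom.obj i ⟶ y

section SpanArr

variable {κ : ArityClass.{w}} {C : Type u} [Category.{v} C]

/-- The array `{a, b} : t ⇒ {x, y}` factors through `P`. -/
def SpanArr.Factors {x y : C} (P : SpanArr κ x y) {t : C} (a : t ⟶ x) (b : t ⟶ y) : Prop :=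
  ∃ (i : P.dom.ι) (h : t ⟶ P.dom.obj i), h ≫ P.fst i = a ∧ h ≫ P.snd i = b

/-- Local refinement `P ≲ Q`: there is a covering family `R` of the domain of `P` such that
`P R` factors through `Q`. -/
def WeakTopology.LocRefines (S : WeakTopology κ C) {x y : C} (P Q : SpanArr κ x y) : Prop :=
  ∃ (V : Fam κ C) (R : FunArr V P.dom), S.IsCovering R ∧
    ∀ v, Q.Factors (R.hom v ≫ P.fst (R.toFun v)) (R.hom v ≫ P.snd (R.toFun v))

/-- `p` holds locally on `t`, i.e. for all members of some covering family of `t`. -/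
def WeakTopology.Locally (S : WeakTopology κ C) (t : C) (p : ∀ ⦃s : C⦄, (s ⟶ t) → Prop) : Prop :=
  ∃ P : Sink.{w} C t, S.Covers P ∧ ∀ i, p (P.map i)

/-- The array `{a, b} : t ⇒ {x, y}` factors locally through `P`. -/
def WeakTopology.Mem (S : WeakTopology κ C) {x y : C} (P : SpanArr κ x y) {t : C}
    (a : t ⟶ x) (b : t ⟶ y) : Prop :=
  S.Locally t fun _ r => P.Factors (r ≫ a) (r ≫ b)

namespace WeakTopology

variable (S : WeakTopology κ C)

variable {S}

theorem Locally.pure {t : C} {p : ∀ ⦃s : C⦄, (s ⟶ t) → Prop} (h : p (𝟙 t)) : S.Locally t p :=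
  ⟨_, S.single t, fun _ => h⟩

theorem Locally.mono {t : C} {p q : ∀ ⦃s : C⦄, (s ⟶ t) → Prop} (h : S.Locally t p)
    (hpq : ∀ ⦃s : C⦄ (r : s ⟶ t), p r → q r) : S.Locally t q := by
  obtain ⟨P, hP, H⟩ := h
  exact ⟨P, hP, fun i => hpq _ (H i)⟩

theorem Locally.bind {t : C} {p : ∀ ⦃s : C⦄, (s ⟶ t) → Prop}
    (h : S.Locally t fun s r => S.Locally s fun _ r' => p (r' ≫ r)) : S.Locally t p := by
  obtain ⟨P, hP, H⟩ := h
  choose Q hQ K using H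
  exact ⟨_, S.bind hP Q hQ, fun k => K k.1 k.2⟩

theorem Locally.pullback {t t' : C} {p : ∀ ⦃s : C⦄, (s ⟶ t) → Prop} (h : S.Locally t p)
    (hp : ∀ ⦃s s' : C⦄ (r : s ⟶ t) (r' : s' ⟶ s), p r → p (r' ≫ r)) (f : t' ⟶ t) :
    S.Locally t' fun _ r => p (r ≫ f) := by
  obtain ⟨P, hP, H⟩ := h
  obtain ⟨Q, hQ, K⟩ := S.pullback hP f
  refine ⟨Q, hQ, fun i => ?_⟩
  obtain ⟨j, h, e⟩ := K i
  have := hp (P.map j) h (H j)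
  rw [e] at this
  exact this

theorem Factors.precomp {x y : C} {P : SpanArr κ x y} {t t' : C} {a : t ⟶ x} {b : t ⟶ y}
    (h : P.Factors a b) (f : t' ⟶ t) : P.Factors (f ≫ a) (f ≫ b) := by
  obtain ⟨i, g, rfl, rfl⟩ := h
  exact ⟨i, f ≫ g, by simp, by simp⟩

theorem Mem.of_factors {x y : C} {P : SpanArr κ x y} {t : C} {a : t ⟶ x} {b : t ⟶ y}
    (h : P.Factors a b) : S.Mem P a b :=
  Locally.pure (by simpa using h)

theorem Mem.precomp {x y : C} {P : SpanArr κ x y} {t t' : C} {a : t ⟶ x} {b : t ⟶ y}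
    (h : S.Mem P a b) (f : t' ⟶ t) : S.Mem P (f ≫ a) (f ≫ b) := by
  refine (Locally.pullback h ?_ f).mono ?_
  · intro s s' r r' hr
    simpa using Factors.precomp hr r'
  · intro s r hr
    simpa using hr

theorem Mem.of_locally {x y : C} {P : SpanArr κ x y} {t : C} {a : t ⟶ x} {b : t ⟶ y}
    (h : S.Locally t fun _ r => S.Mem P (r ≫ a) (r ≫ b)) : S.Mem P a b := by
  refine Locally.bind (h.mono fun s r hr => hr.mono fun s' r' h' => ?_)
  simpa using h'

theorem mem_gen {x y : C} (P : SpanArr κ x y) (i : P.dom.ι) : S.Mem P (P.fst i) (P.snd i) :=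
  Mem.of_factors ⟨i, 𝟙 _, by simp, by simp⟩

theorem locRefines_iff_gen {x y : C} {P Q : SpanArr κ x y} :
    S.LocRefines P Q ↔ ∀ i, S.Mem Q (P.fst i) (P.snd i) := by
  constructor
  · rintro ⟨V, R, hR, H⟩ i
    refine ⟨_, hR i, ?_⟩
    rintro ⟨v, rfl⟩
    simpa [FunArr.fiber] using H v
  · intro H
    choose R hR K using H
    refine ⟨⟨Σ i, (R i).ι, ArityClass.isSmall_sigma P.dom.small fun i => S.small (hR i),
      fun k => (R k.1).obj k.2⟩, ⟨fun k => k.1, fun k => (R k.1).map k.2⟩, ?_, fun k => K k.1 k.2⟩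
    intro i
    refine S.saturated (hR i) ?_ ?_
    · exact ArityClass.isSmall_fiber _
        (ArityClass.isSmall_sigma P.dom.small fun i => S.small (hR i)) P.dom.small i
    · intro j
      exact ⟨⟨⟨i, j⟩, rfl⟩, 𝟙 _, by simp [FunArr.fiber]⟩

theorem locRefines_iff {x y : C} {P Q : SpanArr κ x y} :
    S.LocRefines P Q ↔ ∀ ⦃t : C⦄ (a : t ⟶ x) (b : t ⟶ y), S.Mem P a b → S.Mem Q a b := by
  rw [locRefines_iff_gen]
  constructor
  · intro H t a b h
    refine Mem.of_locally (h.mono ?_)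
    rintro s r ⟨i, g, e₁, e₂⟩
    rw [← e₁, ← e₂]
    exact (H i).precomp g
  · intro H i
    exact H _ _ (mem_gen P i)

variable (S)

theorem locRefines_refl {x y : C} (P : SpanArr κ x y) : S.LocRefines P P :=
  locRefines_iff.2 fun _ _ _ h => h

theorem locRefines_trans {x y : C} {P Q R : SpanArr κ x y} (h : S.LocRefines P Q)
    (h' : S.LocRefines Q R) : S.LocRefines P R :=
  locRefines_iff.2 fun _ _ _ k => locRefines_iff.1 h' _ _ (locRefines_iff.1 h _ _ k)

end WeakTopology

open WeakTopology

/-- The singleton family. -/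
def Fam.single (x : C) : Fam κ C := ⟨PUnit, ArityClass.isSmall_punit, fun _ => x⟩

/-- The array `{1_x, f} : {x} ⇒ {x, y}`. -/
def SpanArr.graph {x y : C} (f : x ⟶ y) : SpanArr κ x y where
  dom := Fam.single x
  fst _ := 𝟙 x
  snd _ := f

/-- The array `Δ_x = {1_x, 1_x} : {x} ⇒ {x, x}`. -/
def SpanArr.diag (x : C) : SpanArr κ x x := SpanArr.graph (𝟙 x)

/-- The array `σ ∘ P`. -/
def SpanArr.swap {x y : C} (P : SpanArr κ x y) : SpanArr κ y x where
  dom := P.dom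
  fst := P.snd
  snd := P.fst

/-- Disjoint union of the domains of a `κ`-small family of arrays. -/
def SpanArr.union {x y : C} {I : Type w} (hI : κ.IsSmall I) (P : I → SpanArr κ x y) :
    SpanArr κ x y where
  dom := ⟨Σ i, (P i).dom.ι, ArityClass.isSmall_sigma hI fun i => (P i).dom.small,
    fun k => (P k.1).dom.obj k.2⟩
  fst k := (P k.1).fst k.2
  snd k := (P k.1).snd k.2

/-- A choice of local `κ`-prelimits of finite diagrams. -/
noncomputable def Topology.prelimit (S : Topology κ C) {D : Type} [SmallCategory D]
    [FinCategory D] (g : D ⥤ C) : LocalPrelimit S.toWeakTopology g :=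
  (S.exists_prelimit D g).some

/-! ### The three finite diagrams used below, as multicospans -/

/-- The cospan `p ⟶ z ⟵ q`. -/
def cospanIndex {p q z : C} (f : p ⟶ z) (g : q ⟶ z) :
    MulticospanIndex ⟨Bool, Unit, fun _ => true, fun _ => false⟩ C where
  left b := match b with
    | true => p
    | false => q
  right _ := z
  fst _ := f
  snd _ := g

/-- The diagram `p ⟶ x ⟵ q`, `p ⟶ y ⟵ q`. -/
def doubleCospanIndex {p q x y : C} (f : p ⟶ x) (f' : p ⟶ y) (g : q ⟶ x) (g' : q ⟶ y) :
    MulticospanIndex ⟨Bool, Bool, fun _ => true, fun _ => false⟩ C where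
  left b := match b with
    | true => p
    | false => q
  right b := match b with
    | true => x
    | false => y
  fst b := match b with
    | true => f
    | false => f'
  snd b := match b with
    | true => g
    | false => g'

/-- The diagram `v ⟶ x ⟵ p ⟶ y ⟵ v'`; the index `none` stands for `p`, the indices `some true`
and `some false` for `v` and `v'`. -/
def zigzagIndex {v v' p x y : C} (f : v ⟶ x) (f' : v' ⟶ y) (a : p ⟶ x) (b : p ⟶ y) :
    MulticospanIndex ⟨Option Bool, Bool, fun b => some b, fun _ => none⟩ C where
  left b := match b with
    | some true => v
    | some false => v'
    | none => p
  right b := match b with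
    | true => x
    | false => y
  fst := fun
    | true => f
    | false => f'
  snd := fun
    | true => a
    | false => b

namespace Topology

variable (S : Topology κ C)

/-- The array `P ×_y Q`, built from local `κ`-prelimits of the cospans
`P_i ⟶ y ⟵ Q_j`. -/
noncomputable def compArr {x y z : C} (P : SpanArr κ x y) (Q : SpanArr κ y z) :
    SpanArr κ x z where
  dom := ⟨Σ k : P.dom.ι × Q.dom.ι, (S.prelimit (cospanIndex (P.snd k.1) (Q.fst k.2)).multicospan).ι,
    ArityClass.isSmall_sigma (ArityClass.isSmall_prod P.dom.small Q.dom.small)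
      fun k => (S.prelimit (cospanIndex (P.snd k.1) (Q.fst k.2)).multicospan).small,
    fun k => ((S.prelimit (cospanIndex (P.snd k.1.1) (Q.fst k.1.2)).multicospan).cone k.2).pt⟩
  fst k := ((S.prelimit (cospanIndex (P.snd k.1.1) (Q.fst k.1.2)).multicospan).cone k.2).π.app
    (.left true) ≫ P.fst k.1.1
  snd k := ((S.prelimit (cospanIndex (P.snd k.1.1) (Q.fst k.1.2)).multicospan).cone k.2).π.app
    (.left false) ≫ Q.snd k.1.2

/-- The array `P ∧ Q`, built from local `κ`-prelimits of the diagrams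
`P_i ⟶ x ⟵ Q_j`, `P_i ⟶ y ⟵ Q_j`. -/
noncomputable def meetArr {x y : C} (P Q : SpanArr κ x y) : SpanArr κ x y where
  dom := ⟨Σ k : P.dom.ι × Q.dom.ι, (S.prelimit
      (doubleCospanIndex (P.fst k.1) (P.snd k.1) (Q.fst k.2) (Q.snd k.2)).multicospan).ι,
    ArityClass.isSmall_sigma (ArityClass.isSmall_prod P.dom.small Q.dom.small)
      fun k => (S.prelimit
        (doubleCospanIndex (P.fst k.1) (P.snd k.1) (Q.fst k.2) (Q.snd k.2)).multicospan).small,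
    fun k => ((S.prelimit (doubleCospanIndex (P.fst k.1.1) (P.snd k.1.1) (Q.fst k.1.2)
      (Q.snd k.1.2)).multicospan).cone k.2).pt⟩
  fst k := ((S.prelimit (doubleCospanIndex (P.fst k.1.1) (P.snd k.1.1) (Q.fst k.1.2)
      (Q.snd k.1.2)).multicospan).cone k.2).π.app (.left true) ≫ P.fst k.1.1
  snd k := ((S.prelimit (doubleCospanIndex (P.fst k.1.1) (P.snd k.1.1) (Q.fst k.1.2)
      (Q.snd k.1.2)).multicospan).cone k.2).π.app (.left true) ≫ P.snd k.1.1

/-- The array `{f, f'}^* P` over `{v, v'}`, built from local `κ`-prelimits of the diagrams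
`v ⟶ x ⟵ P_i ⟶ y ⟵ v'`. -/
noncomputable def pullArr {v v' x y : C} (f : v ⟶ x) (f' : v' ⟶ y) (P : SpanArr κ x y) :
    SpanArr κ v v' where
  dom := ⟨Σ i : P.dom.ι, (S.prelimit (zigzagIndex f f' (P.fst i) (P.snd i)).multicospan).ι,
    ArityClass.isSmall_sigma P.dom.small
      fun i => (S.prelimit (zigzagIndex f f' (P.fst i) (P.snd i)).multicospan).small,
    fun k => ((S.prelimit (zigzagIndex f f' (P.fst k.1) (P.snd k.1)).multicospan).cone k.2).pt⟩
  fst k := ((S.prelimit (zigzagIndex f f' (P.fst k.1) (P.snd k.1)).multicospan).cone k.2).π.app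
    (.left (some true))
  snd k := ((S.prelimit (zigzagIndex f f' (P.fst k.1) (P.snd k.1)).multicospan).cone k.2).π.app
    (.left (some false))

end Topology

/-! ### Characterization of these operations by local factorization -/

theorem mem_graph (S : WeakTopology κ C) {x y : C} (f : x ⟶ y) {t : C} (a : t ⟶ x) (b : t ⟶ y) :
    S.Mem (SpanArr.graph f) a b ↔ S.Locally t fun _ r => r ≫ a ≫ f = r ≫ b := by
  constructor
  · intro h
    refine h.mono ?_
    rintro s r ⟨_, g, e₁, e₂⟩
    simp only [SpanArr.graph, Fam.single] at g e₁ e₂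
    rw [← e₂, ← Category.assoc, ← e₁]
    simp
  · intro h
    refine h.mono ?_
    intro s r e
    exact ⟨PUnit.unit, r ≫ a, by simp [SpanArr.graph, Fam.single],
      by simpa [SpanArr.graph, Fam.single] using e⟩

theorem mem_swap (S : WeakTopology κ C) {x y : C} (P : SpanArr κ x y) {t : C} (a : t ⟶ y)
    (b : t ⟶ x) : S.Mem P.swap a b ↔ S.Mem P b a := by
  constructor <;> intro h <;> refine h.mono ?_ <;> rintro s r ⟨i, g, e₁, e₂⟩ <;>
    exact ⟨i, g, e₂, e₁⟩

theorem mem_union (S : WeakTopology κ C) {x y : C} {I : Type w} (hI : κ.IsSmall I)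
    (P : I → SpanArr κ x y) {t : C} (a : t ⟶ x) (b : t ⟶ y) :
    S.Mem (SpanArr.union hI P) a b ↔ S.Locally t fun _ r => ∃ i, S.Mem (P i) (r ≫ a) (r ≫ b) := by
  constructor
  · intro h
    refine h.mono ?_
    rintro s r ⟨⟨i, k⟩, g, e₁, e₂⟩
    exact ⟨i, Mem.of_factors ⟨k, g, e₁, e₂⟩⟩
  · intro h
    refine Mem.of_locally (h.mono ?_)
    rintro s r ⟨i, hi⟩
    refine hi.mono ?_
    rintro s' r' ⟨k, g, e₁, e₂⟩
    exact ⟨⟨i, k⟩, g, e₁, e₂⟩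

theorem cospan_locally (S : Topology κ C) {p q z : C} (f : p ⟶ z) (g : q ⟶ z) {t : C} (a : t ⟶ p)
    (b : t ⟶ q) (h : a ≫ f = b ≫ g) :
    S.Locally t fun s r => ∃ k, ∃ m : s ⟶ ((S.prelimit (cospanIndex f g).multicospan).cone k).pt,
      m ≫ ((S.prelimit (cospanIndex f g).multicospan).cone k).π.app (.left true) = r ≫ a ∧
      m ≫ ((S.prelimit (cospanIndex f g).multicospan).cone k).π.app (.left false) = r ≫ b := by
  let J := cospanIndex f g
  let K : Multifork J := Multifork.ofι J t
    (fun l => match l with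
      | true => a
      | false => b)
    (fun _ => h)
  obtain ⟨R, hR, H⟩ := (S.prelimit J.multicospan).factors K
  refine ⟨R, hR, fun l => ?_⟩
  obtain ⟨k, m, hm⟩ := H l
  exact ⟨k, m, hm (.left true), hm (.left false)⟩

theorem doubleCospan_locally (S : Topology κ C) {p q x y : C} (f : p ⟶ x) (f' : p ⟶ y) (g : q ⟶ x)
    (g' : q ⟶ y) {t : C} (a : t ⟶ p) (b : t ⟶ q) (h : a ≫ f = b ≫ g) (h' : a ≫ f' = b ≫ g') :
    S.Locally t fun s r => ∃ k, ∃ m : s ⟶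
        ((S.prelimit (doubleCospanIndex f f' g g').multicospan).cone k).pt,
      m ≫ ((S.prelimit (doubleCospanIndex f f' g g').multicospan).cone k).π.app (.left true) =
        r ≫ a := by
  let J := doubleCospanIndex f f' g g'
  let K : Multifork J := Multifork.ofι J t
    (fun l => match l with
      | true => a
      | false => b)
    (fun l => match l with
      | true => h
      | false => h')
  obtain ⟨R, hR, H⟩ := (S.prelimit J.multicospan).factors K
  refine ⟨R, hR, fun l => ?_⟩
  obtain ⟨k, m, hm⟩ := H l
  exact ⟨k, m, hm (.left true)⟩

theorem zigzag_locally (S : Topology κ C) {v v' p x y : C} (f : v ⟶ x) (f' : v' ⟶ y) (a : p ⟶ x)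
    (b : p ⟶ y) {t : C} (c : t ⟶ v) (c' : t ⟶ v') (d : t ⟶ p) (h : c ≫ f = d ≫ a)
    (h' : c' ≫ f' = d ≫ b) :
    S.Locally t fun s r => ∃ k, ∃ m : s ⟶
        ((S.prelimit (zigzagIndex f f' a b).multicospan).cone k).pt,
      m ≫ ((S.prelimit (zigzagIndex f f' a b).multicospan).cone k).π.app (.left (some true)) =
        r ≫ c ∧
      m ≫ ((S.prelimit (zigzagIndex f f' a b).multicospan).cone k).π.app (.left (some false)) =
        r ≫ c' := by
  let J := zigzagIndex f f' a b
  let K : Multifork J := Multifork.ofι J t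
    (fun l => match l with
      | some true => c
      | some false => c'
      | none => d)
    (fun l => match l with
      | true => h
      | false => h')
  obtain ⟨R, hR, H⟩ := (S.prelimit J.multicospan).factors K
  refine ⟨R, hR, fun l => ?_⟩
  obtain ⟨k, m, hm⟩ := H l
  exact ⟨k, m, hm (.left (some true)), hm (.left (some false))⟩

theorem mem_compArr (S : Topology κ C) {x y z : C} (P : SpanArr κ x y) (Q : SpanArr κ y z) {t : C}
    (a : t ⟶ x) (c : t ⟶ z) :
    S.Mem (S.compArr P Q) a c ↔
      S.Locally t fun s r => ∃ b : s ⟶ y, S.Mem P (r ≫ a) b ∧ S.Mem Q b (r ≫ c) := by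
  constructor
  · intro h
    refine h.mono ?_
    rintro s r ⟨⟨⟨i, j⟩, k⟩, g, e₁, e₂⟩
    let K : Multifork (cospanIndex (P.snd i) (Q.fst j)) :=
      (S.prelimit (cospanIndex (P.snd i) (Q.fst j)).multicospan).cone k
    obtain ⟨W, α, β, g, hαβ, e₁, e₂⟩ : ∃ (W : C) (α : W ⟶ P.dom.obj i) (β : W ⟶ Q.dom.obj j)
        (g : s ⟶ W), α ≫ P.snd i = β ≫ Q.fst j ∧ g ≫ α ≫ P.fst i = r ≫ a ∧
          g ≫ β ≫ Q.snd j = r ≫ c :=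
      ⟨_, K.ι true, K.ι false, g, K.condition (), e₁, e₂⟩
    exact ⟨g ≫ α ≫ P.snd i, Mem.of_factors ⟨i, g ≫ α, by simp [e₁], by simp⟩,
      Mem.of_factors ⟨j, g ≫ β, by simp [hαβ], by simp [e₂]⟩⟩
  · intro h
    refine Mem.of_locally (h.mono ?_)
    rintro s r ⟨b, hP, hQ⟩
    refine Locally.bind (hP.mono ?_)
    rintro s₁ r₁ ⟨i, g, e₁, e₂⟩
    refine Locally.bind ((hQ.precomp r₁).mono ?_)
    rintro s₂ r₂ ⟨j, g', e₃, e₄⟩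
    refine (cospan_locally S (P.snd i) (Q.fst j) (r₂ ≫ g) g' (by simp [e₂, e₃])).mono ?_
    rintro s₃ r₃ ⟨k, m, h₁, h₂⟩
    refine ⟨⟨⟨i, j⟩, k⟩, m, ?_, ?_⟩
    · refine (Category.assoc _ _ _).symm.trans ((congrArg (· ≫ P.fst i) h₁).trans ?_)
      simp [e₁]
    · refine (Category.assoc _ _ _).symm.trans ((congrArg (· ≫ Q.snd j) h₂).trans ?_)
      simp [e₄]

theorem mem_meetArr (S : Topology κ C) {x y : C} (P Q : SpanArr κ x y) {t : C}
    (a : t ⟶ x) (b : t ⟶ y) :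
    S.Mem (S.meetArr P Q) a b ↔ S.Mem P a b ∧ S.Mem Q a b := by
  constructor
  · intro h
    have key : S.Locally t fun s r => P.Factors (r ≫ a) (r ≫ b) ∧ Q.Factors (r ≫ a) (r ≫ b) := by
      refine h.mono ?_
      rintro s r ⟨⟨⟨i, j⟩, k⟩, g, e₁, e₂⟩
      let I := doubleCospanIndex (P.fst i) (P.snd i) (Q.fst j) (Q.snd j)
      let K : Multifork I := (S.prelimit I.multicospan).cone k
      obtain ⟨W, α, β, g, h₁, h₂, e₁, e₂⟩ : ∃ (W : C) (α : W ⟶ P.dom.obj i) (β : W ⟶ Q.dom.obj j)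
          (g : s ⟶ W), α ≫ P.fst i = β ≫ Q.fst j ∧ α ≫ P.snd i = β ≫ Q.snd j ∧
          g ≫ α ≫ P.fst i = r ≫ a ∧ g ≫ α ≫ P.snd i = r ≫ b :=
        ⟨_, K.ι true, K.ι false, g, K.condition true, K.condition false, e₁, e₂⟩
      exact ⟨⟨i, g ≫ α, by simp [e₁], by simp [e₂]⟩,
        ⟨j, g ≫ β, by simp [← h₁, e₁], by simp [← h₂, e₂]⟩⟩
    exact ⟨key.mono fun _ _ h => h.1, key.mono fun _ _ h => h.2⟩
  · rintro ⟨hP, hQ⟩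
    refine Locally.bind (hP.mono ?_)
    rintro s₁ r₁ ⟨i, g, e₁, e₂⟩
    refine Locally.bind ((hQ.precomp r₁).mono ?_)
    rintro s₂ r₂ ⟨j, g', e₃, e₄⟩
    refine (doubleCospan_locally S (P.fst i) (P.snd i) (Q.fst j) (Q.snd j) (r₂ ≫ g) g'
      (by simp [e₁, e₃]) (by simp [e₂, e₄])).mono ?_
    rintro s₃ r₃ ⟨k, m, h₁⟩
    refine ⟨⟨⟨i, j⟩, k⟩, m, ?_, ?_⟩
    · refine (Category.assoc _ _ _).symm.trans ((congrArg (· ≫ P.fst i) h₁).trans ?_)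
      simp [e₁]
    · refine (Category.assoc _ _ _).symm.trans ((congrArg (· ≫ P.snd i) h₁).trans ?_)
      simp [e₂]

theorem mem_pullArr (S : Topology κ C) {v v' x y : C} (f : v ⟶ x) (f' : v' ⟶ y)
    (P : SpanArr κ x y) {t : C} (a : t ⟶ v) (b : t ⟶ v') :
    S.Mem (S.pullArr f f' P) a b ↔ S.Mem P (a ≫ f) (b ≫ f') := by
  constructor
  · intro h
    refine h.mono ?_
    rintro s r ⟨⟨i, k⟩, g, e₁, e₂⟩
    let I := zigzagIndex f f' (P.fst i) (P.snd i)
    let K : Multifork I := (S.prelimit I.multicospan).cone k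
    obtain ⟨W, α, β, γ, g, h₁, h₂, e₁, e₂⟩ : ∃ (W : C) (α : W ⟶ v) (β : W ⟶ v')
        (γ : W ⟶ P.dom.obj i) (g : s ⟶ W), α ≫ f = γ ≫ P.fst i ∧ β ≫ f' = γ ≫ P.snd i ∧
        g ≫ α = r ≫ a ∧ g ≫ β = r ≫ b :=
      ⟨_, K.ι (some true), K.ι (some false), K.ι none, g, K.condition true, K.condition false,
        e₁, e₂⟩
    refine ⟨i, g ≫ γ, ?_, ?_⟩
    · rw [Category.assoc, ← h₁, ← Category.assoc, e₁, Category.assoc]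
    · rw [Category.assoc, ← h₂, ← Category.assoc, e₂, Category.assoc]
  · intro h
    refine Locally.bind (h.mono ?_)
    rintro s₁ r₁ ⟨i, g, e₁, e₂⟩
    refine (zigzag_locally S f f' (P.fst i) (P.snd i) (r₁ ≫ a) (r₁ ≫ b) g
      (by simp [e₁]) (by simp [e₂])).mono ?_
    rintro s₂ r₂ ⟨k, m, h₁, h₂⟩
    exact ⟨⟨i, k⟩, m, h₁.trans (Category.assoc _ _ _).symm, h₂.trans (Category.assoc _ _ _).symm⟩

end SpanArr

/-! ## Congruences in a site -/

section SiteCongruence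

variable {κ : ArityClass.{w}} {C : Type u} [Category.{v} C]

/-- A `κ`-ary congruence on the `κ`-ary family `X` in the `κ`-ary site `(C, S)`. -/
structure SiteCongruence (S : Topology κ C) (X : Fam κ C) where
  arr : ∀ i j, SpanArr κ (X.obj i) (X.obj j)
  refl : ∀ i, S.LocRefines (SpanArr.diag (X.obj i)) (arr i i)
  symm : ∀ i j, S.LocRefines (arr i j).swap (arr j i)
  trans : ∀ i j k, S.LocRefines (S.compArr (arr i j) (arr j k)) (arr i k)

namespace SiteCongruence

variable {S : Topology κ C} {X Y : Fam κ C}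

/-- Local refinement of congruences on the same family. -/
def LocRefines (Φ Φ' : SiteCongruence S X) : Prop :=
  ∀ i j, S.LocRefines (Φ.arr i j) (Φ'.arr i j)

theorem mem_refl (Φ : SiteCongruence S X) (i : X.ι) {t : C} (a : t ⟶ X.obj i) :
    S.Mem (Φ.arr i i) a a :=
  WeakTopology.locRefines_iff.1 (Φ.refl i) a a
    ((mem_graph _ _ _ _).2 (WeakTopology.Locally.pure (by simp)))

theorem mem_symm (Φ : SiteCongruence S X) {i j : X.ι} {t : C} {a : t ⟶ X.obj i} {b : t ⟶ X.obj j}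
    (h : S.Mem (Φ.arr i j) a b) : S.Mem (Φ.arr j i) b a :=
  WeakTopology.locRefines_iff.1 (Φ.symm i j) b a ((mem_swap _ _ _ _).2 h)

theorem mem_trans (Φ : SiteCongruence S X) {i j k : X.ι} {t : C} {a : t ⟶ X.obj i}
    {b : t ⟶ X.obj j} {c : t ⟶ X.obj k} (h : S.Mem (Φ.arr i j) a b) (h' : S.Mem (Φ.arr j k) b c) :
    S.Mem (Φ.arr i k) a c :=
  WeakTopology.locRefines_iff.1 (Φ.trans i j k) a c
    ((mem_compArr _ _ _ _ _).2 (WeakTopology.Locally.pure ⟨b, by simpa using h, by simpa using h'⟩))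

/-- The congruence `F^* Ψ`. -/
noncomputable def pullback (F : FunArr X Y) (Ψ : SiteCongruence S Y) : SiteCongruence S X where
  arr i j := S.pullArr (F.hom i) (F.hom j) (Ψ.arr (F.toFun i) (F.toFun j))
  refl i := by
    refine WeakTopology.locRefines_iff.2 fun t a b h => (mem_pullArr _ _ _ _ _ _).2 ?_
    refine WeakTopology.Mem.of_locally (((mem_graph _ _ _ _).1 h).mono fun s r e => ?_)
    have e' : r ≫ a = r ≫ b := by simpa using e
    simp only [← Category.assoc, e']
    exact Ψ.mem_refl _ _
  symm i j := by
    refine WeakTopology.locRefines_iff.2 fun t a b h => (mem_pullArr _ _ _ _ _ _).2 ?_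
    exact Ψ.mem_symm ((mem_pullArr _ _ _ _ _ _).1 ((mem_swap _ _ _ _).1 h))
  trans i j k := by
    refine WeakTopology.locRefines_iff.2 fun t a b h => (mem_pullArr _ _ _ _ _ _).2 ?_
    refine WeakTopology.Mem.of_locally (((mem_compArr _ _ _ _ _).1 h).mono ?_)
    rintro s r ⟨c, h₁, h₂⟩
    have h₁ := (mem_pullArr _ _ _ _ _ _).1 h₁
    have h₂ := (mem_pullArr _ _ _ _ _ _).1 h₂
    simpa using Ψ.mem_trans h₁ h₂

end SiteCongruence

end SiteCongruence

/-! ## Allegories -/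

/-- A `κ`-ary allegory with type of objects `A`. Composition is written in diagrammatic order. -/
structure Allegory (κ : ArityClass.{w}) (A : Type u) where
  Hom : A → A → Type v'
  [order : ∀ x y, SemilatticeInf (Hom x y)]
  id : ∀ x, Hom x x
  comp : ∀ {x y z}, Hom x y → Hom y z → Hom x z
  id_comp : ∀ {x y} (f : Hom x y), comp (id x) f = f
  comp_id : ∀ {x y} (f : Hom x y), comp f (id y) = f
  assoc : ∀ {x y z t} (f : Hom x y) (g : Hom y z) (h : Hom z t),
    comp (comp f g) h = comp f (comp g h)
  comp_le_comp : ∀ {x y z} {f f' : Hom x y} {g g' : Hom y z}, f ≤ f' → g ≤ g' →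
    comp f g ≤ comp f' g'
  /-- `κ`-ary joins. -/
  join : ∀ {x y} {I : Type w}, κ.IsSmall I → (I → Hom x y) → Hom x y
  isLUB_join : ∀ {x y} {I : Type w} (hI : κ.IsSmall I) (f : I → Hom x y),
    IsLUB (Set.range f) (join hI f)
  comp_join : ∀ {x y z} {I : Type w} (hI : κ.IsSmall I) (g : Hom x y) (f : I → Hom y z),
    comp g (join hI f) = join hI fun i => comp g (f i)
  join_comp : ∀ {x y z} {I : Type w} (hI : κ.IsSmall I) (f : I → Hom x y) (g : Hom y z),
    comp (join hI f) g = join hI fun i => comp (f i) g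
  join_inf : ∀ {x y} {I : Type w} (hI : κ.IsSmall I) (f : I → Hom x y) (g : Hom x y),
    join hI f ⊓ g = join hI fun i => f i ⊓ g
  /-- The involution `(-)°`. -/
  inv : ∀ {x y}, Hom x y → Hom y x
  inv_inv : ∀ {x y} (f : Hom x y), inv (inv f) = f
  inv_id : ∀ x, inv (id x) = id x
  inv_comp : ∀ {x y z} (f : Hom x y) (g : Hom y z), inv (comp f g) = comp (inv g) (inv f)
  inv_le_inv : ∀ {x y} {f g : Hom x y}, f ≤ g → inv f ≤ inv g
  modular : ∀ {x y z} (f : Hom x y) (g : Hom y z) (h : Hom x z),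
    comp f g ⊓ h ≤ comp f (g ⊓ comp (inv f) h)

attribute [instance] Allegory.order

namespace Allegory

variable {κ : ArityClass.{w}} {A : Type u} (𝒜 : Allegory.{w, u, v'} κ A)

/-- A map: a morphism with a right adjoint. -/
def IsMap {x y : A} (f : 𝒜.Hom x y) : Prop :=
  ∃ g : 𝒜.Hom y x, 𝒜.id x ≤ 𝒜.comp f g ∧ 𝒜.comp g f ≤ 𝒜.id y

variable {𝒜}

theorem le_join {x y : A} {I : Type w} (hI : κ.IsSmall I) (f : I → 𝒜.Hom x y) (i : I) :
    f i ≤ 𝒜.join hI f := (𝒜.isLUB_join hI f).1 ⟨i, rfl⟩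

theorem join_le {x y : A} {I : Type w} (hI : κ.IsSmall I) {f : I → 𝒜.Hom x y} {g : 𝒜.Hom x y}
    (h : ∀ i, f i ≤ g) : 𝒜.join hI f ≤ g :=
  (𝒜.isLUB_join hI f).2 (by rintro _ ⟨i, rfl⟩; exact h i)

theorem isMap_id (x : A) : 𝒜.IsMap (𝒜.id x) :=
  ⟨𝒜.id x, (𝒜.id_comp _).ge, (𝒜.id_comp _).le⟩

theorem IsMap.comp {x y z : A} {f : 𝒜.Hom x y} {g : 𝒜.Hom y z} (hf : 𝒜.IsMap f)
    (hg : 𝒜.IsMap g) : 𝒜.IsMap (𝒜.comp f g) := by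
  obtain ⟨f', h₁, h₂⟩ := hf
  obtain ⟨g', h₃, h₄⟩ := hg
  refine ⟨𝒜.comp g' f', ?_, ?_⟩
  · calc 𝒜.id x ≤ 𝒜.comp f f' := h₁
      _ = 𝒜.comp f (𝒜.comp (𝒜.id y) f') := by rw [𝒜.id_comp]
      _ ≤ 𝒜.comp f (𝒜.comp (𝒜.comp g g') f') :=
        𝒜.comp_le_comp le_rfl (𝒜.comp_le_comp h₃ le_rfl)
      _ = _ := by simp only [𝒜.assoc]
  · calc _ = 𝒜.comp g' (𝒜.comp (𝒜.comp f' f) g) := by simp only [𝒜.assoc]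
      _ ≤ 𝒜.comp g' (𝒜.comp (𝒜.id y) g) :=
        𝒜.comp_le_comp le_rfl (𝒜.comp_le_comp h₂ le_rfl)
      _ = 𝒜.comp g' g := by rw [𝒜.id_comp]
      _ ≤ 𝒜.id z := h₄

/-- The right adjoint of a map `f` is `f°`. -/
theorem IsMap.inv_adj {x y : A} {f : 𝒜.Hom x y} (hf : 𝒜.IsMap f) :
    𝒜.id x ≤ 𝒜.comp f (𝒜.inv f) ∧ 𝒜.comp (𝒜.inv f) f ≤ 𝒜.id y := by
  have aux : ∀ {x y : A} (f : 𝒜.Hom x y) (g : 𝒜.Hom y x), 𝒜.id x ≤ 𝒜.comp f g →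
      𝒜.comp g f ≤ 𝒜.id y → g ≤ 𝒜.inv f := by
    intro x y f g h₁ h₂
    have k₁ : 𝒜.id x ≤ 𝒜.comp f (g ⊓ 𝒜.inv f) := by
      calc 𝒜.id x ≤ 𝒜.comp f g ⊓ 𝒜.id x := le_inf h₁ le_rfl
        _ ≤ 𝒜.comp f (g ⊓ 𝒜.comp (𝒜.inv f) (𝒜.id x)) := 𝒜.modular _ _ _
        _ = _ := by rw [𝒜.comp_id]
    calc g = 𝒜.comp g (𝒜.id x) := (𝒜.comp_id _).symm
      _ ≤ 𝒜.comp g (𝒜.comp f (g ⊓ 𝒜.inv f)) := 𝒜.comp_le_comp le_rfl k₁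
      _ = 𝒜.comp (𝒜.comp g f) (g ⊓ 𝒜.inv f) := by rw [𝒜.assoc]
      _ ≤ 𝒜.comp (𝒜.id y) (g ⊓ 𝒜.inv f) := 𝒜.comp_le_comp h₂ le_rfl
      _ = g ⊓ 𝒜.inv f := 𝒜.id_comp _
      _ ≤ 𝒜.inv f := inf_le_right
  obtain ⟨g, h₁, h₂⟩ := hf
  have e : g = 𝒜.inv f := by
    refine le_antisymm (aux f g h₁ h₂) ?_
    have k := aux (𝒜.inv g) (𝒜.inv f)
      (by rw [← 𝒜.inv_comp, ← 𝒜.inv_id]; exact 𝒜.inv_le_inv h₁)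
      (by rw [← 𝒜.inv_comp, ← 𝒜.inv_id]; exact 𝒜.inv_le_inv h₂)
    rwa [𝒜.inv_inv] at k
  rw [← e]
  exact ⟨h₁, h₂⟩

variable (𝒜)

/-- The category `Map(𝒜)`: its objects are those of `𝒜` and its morphisms are the maps in `𝒜`. -/
structure MapCat {κ : ArityClass.{w}} {A : Type u} (_𝒜 : Allegory.{w, u, v'} κ A) where
  obj : A

instance : Category.{v'} (MapCat 𝒜) where
  Hom X Y := {f : 𝒜.Hom X.obj Y.obj // 𝒜.IsMap f}
  id _ := ⟨𝒜.id _, isMap_id _⟩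
  comp f g := ⟨𝒜.comp f.1 g.1, f.2.comp g.2⟩
  id_comp _ := Subtype.ext (𝒜.id_comp _)
  comp_id _ := Subtype.ext (𝒜.comp_id _)
  assoc _ _ _ := Subtype.ext (𝒜.assoc _ _ _)

/-! ### Congruences and modules -/

/-- A `κ`-ary congruence on the `κ`-ary family `X` in the allegory `𝒜`. -/
structure Congruence (X : Fam κ A) where
  arr : ∀ i j, 𝒜.Hom (X.obj i) (X.obj j)
  refl : ∀ i, 𝒜.id (X.obj i) ≤ arr i i
  symm : ∀ i j, 𝒜.inv (arr i j) ≤ arr j i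
  trans : ∀ i j k, 𝒜.comp (arr i j) (arr j k) ≤ arr i k

/-- A `κ`-ary congruence in `𝒜`, together with its underlying family. -/
structure ModObj where
  fam : Fam κ A
  cong : 𝒜.Congruence fam

variable {𝒜}

/-- A morphism `Φ ⇸ Θ` in `Mod_κ(𝒜)`: an array `Ψ : X ⇒ Y` with `⋁ ΨΦ ≤ Ψ` and `⋁ ΘΨ ≤ Ψ`. -/
@[ext]
structure ModHom (Φ Θ : 𝒜.ModObj) where
  arr : ∀ i j, 𝒜.Hom (Φ.fam.obj i) (Θ.fam.obj j)
  left : ∀ i i' j, 𝒜.comp (Φ.cong.arr i i') (arr i' j) ≤ arr i j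
  right : ∀ i j j', 𝒜.comp (arr i j) (Θ.cong.arr j j') ≤ arr i j'

theorem Congruence.inv_arr {X : Fam κ A} (Φ : 𝒜.Congruence X) (i j : X.ι) :
    𝒜.inv (Φ.arr i j) = Φ.arr j i := by
  refine le_antisymm (Φ.symm i j) ?_
  have := 𝒜.inv_le_inv (Φ.symm j i)
  rwa [𝒜.inv_inv] at this

theorem join_mono {x y : A} {I : Type w} (hI : κ.IsSmall I) {f g : I → 𝒜.Hom x y}
    (h : ∀ i, f i ≤ g i) : 𝒜.join hI f ≤ 𝒜.join hI g :=
  join_le hI fun i => (h i).trans (le_join hI g i)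

theorem inv_join {x y : A} {I : Type w} (hI : κ.IsSmall I) (f : I → 𝒜.Hom x y) :
    𝒜.inv (𝒜.join hI f) = 𝒜.join hI fun i => 𝒜.inv (f i) := by
  refine le_antisymm ?_ (join_le hI fun i => 𝒜.inv_le_inv (le_join hI f i))
  have : 𝒜.join hI f ≤ 𝒜.inv (𝒜.join hI fun i => 𝒜.inv (f i)) := by
    refine join_le hI fun i => ?_
    have := 𝒜.inv_le_inv (le_join hI (fun i => 𝒜.inv (f i)) i)
    rwa [𝒜.inv_inv] at this
  have := 𝒜.inv_le_inv this
  rwa [𝒜.inv_inv] at this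

theorem join_join {x y : A} {I J : Type w} (hI : κ.IsSmall I) (hJ : κ.IsSmall J)
    (f : I → J → 𝒜.Hom x y) :
    (𝒜.join hI fun i => 𝒜.join hJ fun j => f i j) =
      𝒜.join hJ fun j => 𝒜.join hI fun i => f i j :=
  le_antisymm
    (join_le _ fun i => join_le _ fun j =>
      (le_join hI (fun i => f i j) i).trans (le_join hJ (fun j => 𝒜.join hI fun i => f i j) j))
    (join_le _ fun j => join_le _ fun i =>
      (le_join hJ (fun j => f i j) j).trans (le_join hI (fun i => 𝒜.join hJ fun j => f i j) i))

theorem join_const_le {x y : A} {I : Type w} (hI : κ.IsSmall I) (f : 𝒜.Hom x y) :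
    𝒜.join hI (fun _ => f) ≤ f := join_le hI fun _ => le_rfl

namespace ModHom

/-- Composition in `Mod_κ(𝒜)`: the array `⋁ Ψ'Ψ`. -/
def comp {Φ Θ Ξ : 𝒜.ModObj} (f : ModHom Φ Θ) (g : ModHom Θ Ξ) : ModHom Φ Ξ where
  arr i k := 𝒜.join Θ.fam.small fun j => 𝒜.comp (f.arr i j) (g.arr j k)
  left i i' k := by
    rw [𝒜.comp_join]
    refine join_mono _ fun j => ?_
    rw [← 𝒜.assoc]
    exact 𝒜.comp_le_comp (f.left _ _ _) le_rfl
  right i k k' := by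
    rw [𝒜.join_comp]
    refine join_mono _ fun j => ?_
    rw [𝒜.assoc]
    exact 𝒜.comp_le_comp le_rfl (g.right _ _ _)

/-- The pointwise ordering. -/
instance order (Φ Θ : 𝒜.ModObj) : SemilatticeInf (ModHom Φ Θ) where
  le f g := ∀ i j, f.arr i j ≤ g.arr i j
  le_refl f i j := le_rfl
  le_trans f g h k k' i j := (k i j).trans (k' i j)
  le_antisymm f g k k' := by
    ext i j
    exact le_antisymm (k i j) (k' i j)
  inf f g :=
    { arr i j := f.arr i j ⊓ g.arr i j
      left i i' j := le_inf ((𝒜.comp_le_comp le_rfl inf_le_left).trans (f.left _ _ _))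
        ((𝒜.comp_le_comp le_rfl inf_le_right).trans (g.left _ _ _))
      right i j j' := le_inf ((𝒜.comp_le_comp inf_le_left le_rfl).trans (f.right _ _ _))
        ((𝒜.comp_le_comp inf_le_right le_rfl).trans (g.right _ _ _)) }
  inf_le_left f g i j := inf_le_left
  inf_le_right f g i j := inf_le_right
  le_inf f g h k k' i j := le_inf (k i j) (k' i j)

end ModHom

variable (𝒜)

/-- The `κ`-ary allegory `Mod_κ(𝒜)` of `κ`-ary congruences in `𝒜`. -/
def Mod : Allegory κ 𝒜.ModObj where
  Hom := ModHom
  order := ModHom.order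
  id Φ :=
    { arr := Φ.cong.arr
      left := fun i i' j => Φ.cong.trans i i' j
      right := fun i j j' => Φ.cong.trans i j j' }
  comp := ModHom.comp
  id_comp {Φ Θ} f := by
    ext i j
    refine le_antisymm (join_le _ fun i' => f.left _ _ _) ?_
    refine le_trans ?_ (le_join Φ.fam.small (fun i' => 𝒜.comp (Φ.cong.arr i i') (f.arr i' j)) i)
    calc f.arr i j = 𝒜.comp (𝒜.id _) (f.arr i j) := (𝒜.id_comp _).symm
      _ ≤ _ := 𝒜.comp_le_comp (Φ.cong.refl i) le_rfl
  comp_id {Φ Θ} f := by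
    ext i j
    refine le_antisymm (join_le _ fun i' => f.right _ _ _) ?_
    refine le_trans ?_ (le_join Θ.fam.small (fun j' => 𝒜.comp (f.arr i j') (Θ.cong.arr j' j)) j)
    calc f.arr i j = 𝒜.comp (f.arr i j) (𝒜.id _) := (𝒜.comp_id _).symm
      _ ≤ _ := 𝒜.comp_le_comp le_rfl (Θ.cong.refl j)
  assoc {Φ Θ Ξ Λ} f g h := by
    ext i l
    simp only [ModHom.comp, 𝒜.comp_join, 𝒜.join_comp, 𝒜.assoc]
    exact join_join _ _ _
  comp_le_comp h h' i k := join_mono _ fun j => 𝒜.comp_le_comp (h i j) (h' j k)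
  join {Φ Θ I} hI f :=
    { arr i j := 𝒜.join hI fun a => (f a).arr i j
      left i i' j := by
        rw [𝒜.comp_join]
        exact join_mono _ fun a => (f a).left _ _ _
      right i j j' := by
        rw [𝒜.join_comp]
        exact join_mono _ fun a => (f a).right _ _ _ }
  isLUB_join {Φ Θ I} hI f := by
    constructor
    · rintro _ ⟨a, rfl⟩ i j
      exact le_join hI (fun a => (f a).arr i j) a
    · intro g hg i j
      exact join_le hI fun a => hg ⟨a, rfl⟩ i j
  comp_join {Φ Θ Ξ I} hI g f := by
    ext i k
    simp only [ModHom.comp, 𝒜.comp_join]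
    exact join_join _ _ _
  join_comp {Φ Θ Ξ I} hI f g := by
    ext i k
    simp only [ModHom.comp, 𝒜.join_comp]
    exact join_join _ _ _
  join_inf {Φ Θ I} hI f g := by
    ext i j
    exact 𝒜.join_inf hI (fun a => (f a).arr i j) (g.arr i j)
  inv {Φ Θ} f :=
    { arr j i := 𝒜.inv (f.arr i j)
      left j j' i := by
        rw [← Θ.cong.inv_arr, ← 𝒜.inv_comp]
        exact 𝒜.inv_le_inv (f.right _ _ _)
      right j i i' := by
        rw [← Φ.cong.inv_arr, ← 𝒜.inv_comp]
        exact 𝒜.inv_le_inv (f.left _ _ _) }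
  inv_inv f := by
    ext i j
    exact 𝒜.inv_inv _
  inv_id Φ := by
    ext i j
    exact Φ.cong.inv_arr j i
  inv_comp f g := by
    ext i k
    simp only [ModHom.comp, inv_join, 𝒜.inv_comp]
  inv_le_inv h i j := 𝒜.inv_le_inv (h j i)
  modular {Φ Θ Ξ} f g h := by
    intro i k
    change 𝒜.join _ _ ⊓ h.arr i k ≤ 𝒜.join _ _
    rw [𝒜.join_inf]
    refine join_mono _ fun j => (𝒜.modular _ _ _).trans (𝒜.comp_le_comp le_rfl ?_)
    exact inf_le_inf le_rfl
      (le_join Φ.fam.small (fun i' => 𝒜.comp (𝒜.inv (f.arr i' j)) (h.arr i' k)) i)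

end Allegory

/-! ## Framed allegories -/

/-- A framed `κ`-ary allegory whose category of tight maps is `T`. The bijective-on-objects functor
from tight maps to maps is taken to be the identity on objects; its action on morphisms is `J`. -/
structure FramedAllegory (κ : ArityClass.{w}) (T : Type u) [Category.{v} T] extends
    Allegory.{w, u, v'} κ T where
  J : ∀ {x y : T}, (x ⟶ y) → Hom x y
  J_id : ∀ x : T, J (𝟙 x) = id x
  J_comp : ∀ {x y z : T} (f : x ⟶ y) (g : y ⟶ z), J (f ≫ g) = comp (J f) (J g)
  isMap_J : ∀ {x y : T} (f : x ⟶ y), toAllegory.IsMap (J f)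

namespace FramedAllegory

variable {κ : ArityClass.{w}} {T : Type u} [Category.{v} T] (𝔸 : FramedAllegory.{w, u, v, v'} κ T)

/-- The functor from tight maps to (loose) maps. -/
def toMap : T ⥤ 𝔸.MapCat where
  obj x := ⟨x⟩
  map f := ⟨𝔸.J f, 𝔸.isMap_J f⟩
  map_id x := Subtype.ext (𝔸.J_id x)
  map_comp f g := Subtype.ext (𝔸.J_comp f g)

/-- The weak equivalences: tight maps whose underlying loose map is an isomorphism. -/
def weakEq : MorphismProperty T := fun x y f =>
  ∃ g : 𝔸.Hom y x, 𝔸.comp (𝔸.J f) g = 𝔸.id x ∧ 𝔸.comp g (𝔸.J f) = 𝔸.id y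

/-- A `κ`-ary cocone `P` of tight maps is covering if `⋁ P_• P^• = 1`. -/
def Covers {x : T} (P : Sink.{w} T x) : Prop :=
  κ.IsSmall P.ι ∧
    IsLUB (Set.range fun i => 𝔸.comp (𝔸.inv (𝔸.J (P.map i))) (𝔸.J (P.map i))) (𝔸.id x)

/-- A covering family of a `κ`-ary family of objects. -/
def IsCovering {V U : Fam κ T} (P : FunArr V U) : Prop := ∀ i, 𝔸.Covers (P.fiber i)

/-- Weak `κ`-tabularity. -/
structure WeaklyTabular : Prop where
  exists_tabulation : ∀ {x y : T} (φ : 𝔸.Hom x y), ∃ (Z : Fam κ T) (F : ∀ z, Z.obj z ⟶ y)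
    (G : ∀ z, Z.obj z ⟶ x), φ = 𝔸.join Z.small fun z => 𝔸.comp (𝔸.inv (𝔸.J (G z))) (𝔸.J (F z))
  exists_cover : ∀ {x y : T} (f g : x ⟶ y), 𝔸.J f = 𝔸.J g →
    ∃ P : Sink.{w} T x, 𝔸.Covers P ∧ ∀ i, P.map i ≫ f = P.map i ≫ g

/-- The cocone `Ψ : X ⇒ z` is a collage (lax colimit) of the congruence `Φ`. -/
structure IsCollage {X : Fam κ T} (Φ : 𝔸.Congruence X) {z : T} (Ψ : ∀ i, 𝔸.Hom (X.obj i) z) :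
    Prop where
  cocone : ∀ i j, 𝔸.comp (Φ.arr i j) (Ψ j) ≤ Ψ i
  exists_desc : ∀ {t : T} (Θ : ∀ i, 𝔸.Hom (X.obj i) t),
    (∀ i j, 𝔸.comp (Φ.arr i j) (Θ j) ≤ Θ i) → ∃ χ : 𝔸.Hom z t, ∀ i, 𝔸.comp (Ψ i) χ = Θ i
  le_of_le : ∀ {t : T} (χ χ' : 𝔸.Hom z t),
    (∀ i, 𝔸.comp (Ψ i) χ ≤ 𝔸.comp (Ψ i) χ') → χ ≤ χ'

/-- The cocone `F : X ⇒ z` of tight maps is a tight collage of the congruence `Φ`: it is a collage,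
and for each `χ : z ⇸ t` composition with `F` is a bijection from the tight maps `h` with
`h_• = χ` to the tight cocones `G` with `G_• = χ F_•`. -/
structure IsTightCollage {X : Fam κ T} (Φ : 𝔸.Congruence X) {z : T} (F : ∀ i, X.obj i ⟶ z) :
    Prop where
  isCollage : 𝔸.IsCollage Φ fun i => 𝔸.J (F i)
  bijective : ∀ {t : T} (χ : 𝔸.Hom z t) (G : ∀ i, X.obj i ⟶ t),
    (∀ i, 𝔸.J (G i) = 𝔸.comp (𝔸.J (F i)) χ) →
      ∃! h : z ⟶ t, 𝔸.J h = χ ∧ ∀ i, F i ≫ h = G i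

/-- Every `κ`-ary congruence has a tight collage. -/
def HasTightCollages : Prop :=
  ∀ {X : Fam κ T} (Φ : 𝔸.Congruence X), ∃ (z : T) (F : ∀ i, X.obj i ⟶ z), 𝔸.IsTightCollage Φ F

variable {𝔸}

/-- A tight map `Φ ⟶ Θ` between congruences: a functional array `G` of tight maps with
`⋁ G_• Φ ≤ Θ G_•`. -/
structure TightMap (Φ Θ : 𝔸.ModObj) where
  arr : FunArr Φ.fam Θ.fam
  le : ∀ i i', 𝔸.comp (Φ.cong.arr i i') (𝔸.J (arr.hom i')) ≤
    𝔸.comp (𝔸.J (arr.hom i)) (Θ.cong.arr (arr.toFun i) (arr.toFun i'))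

theorem J_adj_unit {x y : T} (f : x ⟶ y) : 𝔸.id x ≤ 𝔸.comp (𝔸.J f) (𝔸.inv (𝔸.J f)) :=
  (𝔸.isMap_J f).inv_adj.1

theorem J_adj_counit {x y : T} (f : x ⟶ y) : 𝔸.comp (𝔸.inv (𝔸.J f)) (𝔸.J f) ≤ 𝔸.id y :=
  (𝔸.isMap_J f).inv_adj.2

/-- The map `G_◆ = Θ G_•` in `Mod_κ(𝒜)` underlying a tight map `G : Φ ⟶ Θ`. -/
def TightMap.toMap {Φ Θ : 𝔸.ModObj} (G : TightMap Φ Θ) :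
    (⟨Φ⟩ : 𝔸.Mod.MapCat) ⟶ ⟨Θ⟩ :=
  ⟨{ arr := fun i j => 𝔸.comp (𝔸.J (G.arr.hom i)) (Θ.cong.arr (G.arr.toFun i) j)
     left := fun i i' j => by
      rw [← 𝔸.assoc]
      refine (𝔸.comp_le_comp (G.le i i') le_rfl).trans ?_
      rw [𝔸.assoc]
      exact 𝔸.comp_le_comp le_rfl (Θ.cong.trans _ _ _)
     right := fun i j j' => by
      rw [𝔸.assoc]
      exact 𝔸.comp_le_comp le_rfl (Θ.cong.trans _ _ _) }, by
    refine ⟨{ arr := fun j i => 𝔸.comp (Θ.cong.arr j (G.arr.toFun i)) (𝔸.inv (𝔸.J (G.arr.hom i)))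
              left := ?_
              right := ?_ }, ?_, ?_⟩
    · intro j j' i
      rw [← 𝔸.assoc]
      exact 𝔸.comp_le_comp (Θ.cong.trans _ _ _) le_rfl
    · intro j i i'
      have h := 𝔸.inv_le_inv (G.le i' i)
      simp only [𝔸.inv_comp, Allegory.Congruence.inv_arr] at h
      rw [𝔸.assoc]
      refine (𝔸.comp_le_comp le_rfl h).trans ?_
      rw [← 𝔸.assoc]
      exact 𝔸.comp_le_comp (Θ.cong.trans _ _ _) le_rfl
    · intro i i'
      refine le_trans ?_ (Allegory.le_join Θ.fam.small _ (G.arr.toFun i'))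
      change Φ.cong.arr i i' ≤ _
      have h : Φ.cong.arr i i' ≤ 𝔸.comp (𝔸.comp (𝔸.J (G.arr.hom i))
          (Θ.cong.arr (G.arr.toFun i) (G.arr.toFun i'))) (𝔸.inv (𝔸.J (G.arr.hom i'))) := by
        calc Φ.cong.arr i i' = 𝔸.comp (Φ.cong.arr i i') (𝔸.id _) := (𝔸.comp_id _).symm
          _ ≤ 𝔸.comp (Φ.cong.arr i i') (𝔸.comp (𝔸.J (G.arr.hom i'))
              (𝔸.inv (𝔸.J (G.arr.hom i')))) := 𝔸.comp_le_comp le_rfl (J_adj_unit _)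
          _ = 𝔸.comp (𝔸.comp (Φ.cong.arr i i') (𝔸.J (G.arr.hom i')))
              (𝔸.inv (𝔸.J (G.arr.hom i'))) := (𝔸.assoc _ _ _).symm
          _ ≤ _ := 𝔸.comp_le_comp (G.le i i') le_rfl
      refine h.trans (𝔸.comp_le_comp le_rfl ?_)
      calc 𝔸.inv (𝔸.J (G.arr.hom i')) = 𝔸.comp (𝔸.id _) (𝔸.inv (𝔸.J (G.arr.hom i'))) :=
            (𝔸.id_comp _).symm
        _ ≤ _ := 𝔸.comp_le_comp (Θ.cong.refl _) le_rfl
    · intro j j'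
      refine Allegory.join_le Φ.fam.small fun i => ?_
      change 𝔸.comp (𝔸.comp (Θ.cong.arr j (G.arr.toFun i)) (𝔸.inv (𝔸.J (G.arr.hom i))))
        (𝔸.comp (𝔸.J (G.arr.hom i)) (Θ.cong.arr (G.arr.toFun i) j')) ≤ Θ.cong.arr j j'
      rw [𝔸.assoc, ← 𝔸.assoc (𝔸.inv _)]
      refine (𝔸.comp_le_comp le_rfl (𝔸.comp_le_comp (J_adj_counit _) le_rfl)).trans ?_
      rw [𝔸.id_comp]
      exact Θ.cong.trans _ _ _⟩

/-- The congruence `F^• Θ F_•`. -/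
def pullbackCong {X Y : Fam κ T} (F : FunArr X Y) (Θ : 𝔸.Congruence Y) : 𝔸.Congruence X where
  arr i j := 𝔸.comp (𝔸.J (F.hom i))
    (𝔸.comp (Θ.arr (F.toFun i) (F.toFun j)) (𝔸.inv (𝔸.J (F.hom j))))
  refl i := by
    refine (J_adj_unit (F.hom i)).trans (𝔸.comp_le_comp le_rfl ?_)
    calc 𝔸.inv (𝔸.J (F.hom i)) = 𝔸.comp (𝔸.id _) (𝔸.inv (𝔸.J (F.hom i))) := (𝔸.id_comp _).symm
      _ ≤ _ := 𝔸.comp_le_comp (Θ.refl _) le_rfl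
  symm i j := by
    simp only [𝔸.inv_comp, Allegory.Congruence.inv_arr, 𝔸.inv_inv, 𝔸.assoc]
    exact le_rfl
  trans i j k := by
    have h : 𝔸.comp (𝔸.inv (𝔸.J (F.hom j))) (𝔸.comp (𝔸.J (F.hom j))
        (𝔸.comp (Θ.arr (F.toFun j) (F.toFun k)) (𝔸.inv (𝔸.J (F.hom k))))) ≤
        𝔸.comp (Θ.arr (F.toFun j) (F.toFun k)) (𝔸.inv (𝔸.J (F.hom k))) := by
      rw [← 𝔸.assoc]
      refine (𝔸.comp_le_comp (J_adj_counit _) le_rfl).trans ?_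
      rw [𝔸.id_comp]
    rw [𝔸.assoc, 𝔸.assoc]
    refine 𝔸.comp_le_comp le_rfl ((𝔸.comp_le_comp le_rfl h).trans ?_)
    rw [← 𝔸.assoc]
    exact 𝔸.comp_le_comp (Θ.trans _ _ _) le_rfl

/-- A tight map out of `F^• Φ F_•` from the inequality `P^• Φ P_• ≤ F^• Θ F_•`. -/
def TightMap.ofLE {W : Fam κ T} {Λ : 𝔸.Congruence W} {Θ : 𝔸.ModObj} (F : FunArr W Θ.fam)
    (h : ∀ i j, Λ.arr i j ≤ (pullbackCong F Θ.cong).arr i j) : TightMap ⟨W, Λ⟩ Θ where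
  arr := F
  le i i' := by
    refine (𝔸.comp_le_comp (h i i') le_rfl).trans ?_
    change 𝔸.comp (𝔸.comp _ (𝔸.comp _ _)) _ ≤ _
    rw [𝔸.assoc, 𝔸.assoc]
    refine 𝔸.comp_le_comp le_rfl ((𝔸.comp_le_comp le_rfl (J_adj_counit _)).trans ?_)
    rw [𝔸.comp_id]

/-- A span `X ⇐ W ⇒ Y` of functional arrays of tight maps, with left leg `P` a covering family,
such that `P^• Φ P_• ≤ F^• Θ F_•`. -/
structure Ana (Φ Θ : 𝔸.ModObj) where
  apex : Fam κ T
  P : FunArr apex Φ.fam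
  F : FunArr apex Θ.fam
  isCovering : 𝔸.IsCovering P
  le : ∀ i j, (pullbackCong P Φ.cong).arr i j ≤ (pullbackCong F Θ.cong).arr i j

namespace Ana

variable {Φ Θ : 𝔸.ModObj}

/-- The apex of a span, with the congruence `P^• Φ P_•`. -/
def dom (s : Ana Φ Θ) : 𝔸.ModObj := ⟨s.apex, pullbackCong s.P Φ.cong⟩

/-- The left leg as a map `P_◆` in `Mod_κ(𝒜)`. -/
def left (s : Ana Φ Θ) : (⟨s.dom⟩ : 𝔸.Mod.MapCat) ⟶ ⟨Φ⟩ :=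
  (TightMap.ofLE s.P fun _ _ => le_rfl).toMap

/-- The right leg as a map `F_◆` in `Mod_κ(𝒜)`. -/
def right (s : Ana Φ Θ) : (⟨s.dom⟩ : 𝔸.Mod.MapCat) ⟶ ⟨Θ⟩ :=
  (TightMap.ofLE s.F s.le).toMap

/-- The span `(P, F)` represents the map `m : Φ ⟶ Θ` if `m P_◆ = F_◆`. -/
def Represents (s : Ana Φ Θ) (m : (⟨Φ⟩ : 𝔸.Mod.MapCat) ⟶ ⟨Θ⟩) : Prop := s.left ≫ m = s.right

/-- There are functional arrays `S : U ⇒ W`, `S' : U ⇒ W'` such that `P S = P' S'` is a covering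
family and `⋁ (F S)_• (F' S')^• ≤ Θ`. -/
def Rel (s s' : Ana Φ Θ) : Prop :=
  ∃ (U : Fam κ T) (S : FunArr U s.apex) (S' : FunArr U s'.apex),
    S.comp s.P = S'.comp s'.P ∧ 𝔸.IsCovering (S.comp s.P) ∧
      ∀ i, 𝔸.comp (𝔸.inv (𝔸.J ((S'.comp s'.F).hom i))) (𝔸.J ((S.comp s.F).hom i)) ≤
        Θ.cong.arr ((S'.comp s'.F).toFun i) ((S.comp s.F).toFun i)

end Ana

end FramedAllegory

/-! ## The framed allegory of relations in a site -/

section Rel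

variable {κ : ArityClass.{w}} {C : Type u} [Category.{v} C] (S : Topology κ C)

/-- Local equivalence of arrays: local refinement in both directions. -/
@[reducible]
def locSetoid (x y : C) : Setoid (SpanArr κ x y) where
  r P Q := S.LocRefines P Q ∧ S.LocRefines Q P
  iseqv :=
    { refl := fun P => ⟨S.locRefines_refl P, S.locRefines_refl P⟩
      symm := fun h => ⟨h.2, h.1⟩
      trans := fun h h' => ⟨S.locRefines_trans h.1 h'.1, S.locRefines_trans h'.2 h.2⟩ }

/-- A morphism `x ⇸ y` in `Rel_κ(C)`: an element of the poset reflection of the preorder of arrays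
over `{x, y}` under local refinement. -/
def RelMor (x y : C) : Type (max (w + 1) u v) := Quotient (locSetoid S x y)

variable {S}

/-- The class of an array. -/
def RelMor.mk {x y : C} (P : SpanArr κ x y) : RelMor S x y := Quotient.mk (locSetoid S x y) P

namespace RelMor

open WeakTopology

/-- Local factorization through a representative. -/
def Mem {x y : C} (f : RelMor S x y) {t : C} (a : t ⟶ x) (b : t ⟶ y) : Prop :=
  Quotient.lift (s := locSetoid S x y) (fun P => S.Mem P a b)
    (fun _ _ h => propext ⟨locRefines_iff.1 h.1 a b, locRefines_iff.1 h.2 a b⟩) f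

theorem ind {x y : C} {p : RelMor S x y → Prop} (h : ∀ P, p (RelMor.mk P)) (f : RelMor S x y) :
    p f := Quotient.ind h f

@[simp]
theorem mem_mk {x y : C} (P : SpanArr κ x y) {t : C} (a : t ⟶ x) (b : t ⟶ y) :
    (RelMor.mk P : RelMor S x y).Mem a b ↔ S.Mem P a b := Iff.rfl

theorem mk_eq_iff {x y : C} {P Q : SpanArr κ x y} :
    (RelMor.mk P : RelMor S x y) = RelMor.mk Q ↔ S.LocRefines P Q ∧ S.LocRefines Q P :=
  ⟨fun h => Quotient.exact h, fun h => Quotient.sound h⟩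

theorem ext_mem {x y : C} {f g : RelMor S x y}
    (h : ∀ ⦃t : C⦄ (a : t ⟶ x) (b : t ⟶ y), f.Mem a b ↔ g.Mem a b) : f = g := by
  induction f using RelMor.ind
  induction g using RelMor.ind
  exact mk_eq_iff.2 ⟨locRefines_iff.2 fun _ a b => (h a b).1, locRefines_iff.2 fun _ a b => (h a b).2⟩

theorem Mem.precomp {x y : C} {f : RelMor S x y} {t t' : C} {a : t ⟶ x} {b : t ⟶ y}
    (h : f.Mem a b) (r : t' ⟶ t) : f.Mem (r ≫ a) (r ≫ b) := by
  induction f using RelMor.ind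
  exact WeakTopology.Mem.precomp h r

theorem Mem.of_locally {x y : C} {f : RelMor S x y} {t : C} {a : t ⟶ x} {b : t ⟶ y}
    (h : S.Locally t fun _ r => f.Mem (r ≫ a) (r ≫ b)) : f.Mem a b := by
  induction f using RelMor.ind
  exact WeakTopology.Mem.of_locally h

/-- Composition, in diagrammatic order. -/
noncomputable def comp {x y z : C} (f : RelMor S x y) (g : RelMor S y z) : RelMor S x z :=
  Quotient.map₂ (sa := locSetoid S x y) (sb := locSetoid S y z) (sc := locSetoid S x z)
    S.compArr (by
      have key : ∀ {P P' : SpanArr κ x y} {Q Q' : SpanArr κ y z}, S.LocRefines P P' →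
          S.LocRefines Q Q' → S.LocRefines (S.compArr P Q) (S.compArr P' Q') := by
        intro P P' Q Q' h h'
        refine locRefines_iff.2 fun t a b k => (mem_compArr _ _ _ _ _).2 ?_
        refine ((mem_compArr _ _ _ _ _).1 k).mono ?_
        rintro s r ⟨c, h₁, h₂⟩
        exact ⟨c, locRefines_iff.1 h _ _ h₁, locRefines_iff.1 h' _ _ h₂⟩
      exact fun P P' h Q Q' h' => ⟨key h.1 h'.1, key h.2 h'.2⟩) f g

theorem mem_comp {x y z : C} (f : RelMor S x y) (g : RelMor S y z) {t : C} (a : t ⟶ x)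
    (c : t ⟶ z) : (f.comp g).Mem a c ↔
      S.Locally t fun s r => ∃ b : s ⟶ y, f.Mem (r ≫ a) b ∧ g.Mem b (r ≫ c) := by
  induction f using RelMor.ind
  induction g using RelMor.ind
  exact mem_compArr _ _ _ _ _

/-- The involution. -/
def inv {x y : C} (f : RelMor S x y) : RelMor S y x :=
  Quotient.map (sa := locSetoid S x y) (sb := locSetoid S y x) SpanArr.swap (by
    have key : ∀ {P P' : SpanArr κ x y}, S.LocRefines P P' → S.LocRefines P.swap P'.swap :=
      fun h => locRefines_iff.2 fun t a b k =>
        (mem_swap _ _ _ _).2 (locRefines_iff.1 h _ _ ((mem_swap _ _ _ _).1 k))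
    exact fun P P' h => ⟨key h.1, key h.2⟩) f

theorem mem_inv {x y : C} (f : RelMor S x y) {t : C} (a : t ⟶ y) (b : t ⟶ x) :
    f.inv.Mem a b ↔ f.Mem b a := by
  induction f using RelMor.ind
  exact mem_swap _ _ _ _

/-- Binary meets. -/
noncomputable def inf {x y : C} (f g : RelMor S x y) : RelMor S x y :=
  Quotient.map₂ (sa := locSetoid S x y) (sb := locSetoid S x y) (sc := locSetoid S x y)
    S.meetArr (by
      have key : ∀ {P P' Q Q' : SpanArr κ x y}, S.LocRefines P P' →
          S.LocRefines Q Q' → S.LocRefines (S.meetArr P Q) (S.meetArr P' Q') := by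
        intro P P' Q Q' h h'
        refine locRefines_iff.2 fun t a b k => (mem_meetArr _ _ _ _ _).2 ?_
        have k := (mem_meetArr _ _ _ _ _).1 k
        exact ⟨locRefines_iff.1 h _ _ k.1, locRefines_iff.1 h' _ _ k.2⟩
      exact fun P P' h Q Q' h' => ⟨key h.1 h'.1, key h.2 h'.2⟩) f g

theorem mem_inf {x y : C} (f g : RelMor S x y) {t : C} (a : t ⟶ x) (b : t ⟶ y) :
    (f.inf g).Mem a b ↔ f.Mem a b ∧ g.Mem a b := by
  induction f using RelMor.ind
  induction g using RelMor.ind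
  exact mem_meetArr _ _ _ _ _

/-- `κ`-ary joins: the class of the disjoint union of representatives. -/
noncomputable def join {x y : C} {I : Type w} (hI : κ.IsSmall I) (f : I → RelMor S x y) :
    RelMor S x y :=
  RelMor.mk (SpanArr.union hI fun i => Quotient.out (s := locSetoid S x y) (f i))

theorem mem_join {x y : C} {I : Type w} (hI : κ.IsSmall I) (f : I → RelMor S x y) {t : C}
    (a : t ⟶ x) (b : t ⟶ y) :
    (join hI f).Mem a b ↔ S.Locally t fun _ r => ∃ i, (f i).Mem (r ≫ a) (r ≫ b) := by
  have h : ∀ i {s : C} (c : s ⟶ x) (d : s ⟶ y), (f i).Mem c d ↔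
      S.Mem (Quotient.out (s := locSetoid S x y) (f i)) c d := by
    intro i s c d
    rw [← RelMor.mem_mk]
    exact iff_of_eq (congrArg (fun g : RelMor S x y => g.Mem c d)
      (Quotient.out_eq (s := locSetoid S x y) (f i)).symm)
  simp only [h]
  exact mem_union _ _ _ _ _

/-- The order induced by local refinement, in which meets are given by `RelMor.inf`. -/
noncomputable instance order (x y : C) : SemilatticeInf (RelMor S x y) where
  le f g := Quotient.lift₂ (s₁ := locSetoid S x y) (s₂ := locSetoid S x y)
    (fun P Q => S.LocRefines P Q) (fun _ _ _ _ h h' => propext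
      ⟨fun k => S.locRefines_trans h.2 (S.locRefines_trans k h'.1),
        fun k => S.locRefines_trans h.1 (S.locRefines_trans k h'.2)⟩) f g
  le_refl f := by
    induction f using RelMor.ind
    exact S.locRefines_refl _
  le_trans f g h := by
    induction f using RelMor.ind
    induction g using RelMor.ind
    induction h using RelMor.ind
    exact S.locRefines_trans
  le_antisymm f g h h' := by
    induction f using RelMor.ind
    induction g using RelMor.ind
    exact mk_eq_iff.2 ⟨h, h'⟩
  inf := RelMor.inf
  inf_le_left f g := by
    induction f using RelMor.ind
    induction g using RelMor.ind
    exact locRefines_iff.2 fun t a b h => ((mem_meetArr _ _ _ _ _).1 h).1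
  inf_le_right f g := by
    induction f using RelMor.ind
    induction g using RelMor.ind
    exact locRefines_iff.2 fun t a b h => ((mem_meetArr _ _ _ _ _).1 h).2
  le_inf f g h := by
    induction f using RelMor.ind
    induction g using RelMor.ind
    induction h using RelMor.ind
    exact fun k k' => locRefines_iff.2 fun t a b m => (mem_meetArr _ _ _ _ _).2
      ⟨locRefines_iff.1 k _ _ m, locRefines_iff.1 k' _ _ m⟩

theorem mk_le_mk {x y : C} {P Q : SpanArr κ x y} :
    (RelMor.mk P : RelMor S x y) ≤ RelMor.mk Q ↔ S.LocRefines P Q := Iff.rfl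

theorem le_iff {x y : C} {f g : RelMor S x y} :
    f ≤ g ↔ ∀ ⦃t : C⦄ (a : t ⟶ x) (b : t ⟶ y), f.Mem a b → g.Mem a b := by
  induction f using RelMor.ind
  induction g using RelMor.ind
  exact locRefines_iff

theorem mem_diag {x t : C} (a b : t ⟶ x) :
    (RelMor.mk (SpanArr.diag x) : RelMor S x x).Mem a b ↔ S.Locally t fun _ r => r ≫ a = r ≫ b := by
  refine (mem_graph _ _ _ _).trans ?_
  simp

theorem mem_of_locally_eq {x y t : C} {f : RelMor S x y} {a a' : t ⟶ x} {b b' : t ⟶ y}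
    (ha : S.Locally t fun _ r => r ≫ a = r ≫ a') (hb : S.Locally t fun _ r => r ≫ b = r ≫ b')
    (h : f.Mem a b) : f.Mem a' b' := by
  refine Mem.of_locally (Locally.bind (ha.mono fun s r e => ?_))
  refine (hb.pullback (fun s s' r r' e => by simp [e]) r).mono fun s' r' e' => ?_
  have := h.precomp (r' ≫ r)
  rw [Category.assoc, e] at this
  rw [e'] at this
  simpa using this

end RelMor

open WeakTopology

variable (S)

/-- The `κ`-ary allegory underlying `Rel_κ(C)`. -/
noncomputable def relAllegory : Allegory.{w, u, max (w + 1) u v} κ C where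
  Hom := RelMor S
  order := RelMor.order
  id x := RelMor.mk (SpanArr.diag x)
  comp := RelMor.comp
  id_comp {x y} f := by
    refine RelMor.ext_mem fun t a b => ?_
    rw [RelMor.mem_comp]
    constructor
    · intro h
      refine RelMor.Mem.of_locally (h.mono ?_)
      rintro s r ⟨c, h₁, h₂⟩
      refine RelMor.mem_of_locally_eq (((RelMor.mem_diag _ _).1 h₁).mono fun _ _ e => e.symm)
        (Locally.pure rfl) h₂
    · intro h
      exact Locally.pure ⟨a, (RelMor.mem_diag _ _).2 (Locally.pure (by simp)), by simpa using h⟩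
  comp_id {x y} f := by
    refine RelMor.ext_mem fun t a b => ?_
    rw [RelMor.mem_comp]
    constructor
    · intro h
      refine RelMor.Mem.of_locally (h.mono ?_)
      rintro s r ⟨c, h₁, h₂⟩
      exact RelMor.mem_of_locally_eq (Locally.pure rfl) ((RelMor.mem_diag _ _).1 h₂) h₁
    · intro h
      exact Locally.pure ⟨b, by simpa using h, (RelMor.mem_diag _ _).2 (Locally.pure (by simp))⟩
  assoc {x y z t} f g h := by
    refine RelMor.ext_mem fun t a b => ?_
    simp only [RelMor.mem_comp]
    constructor
    · intro H
      refine Locally.bind (H.mono ?_)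
      rintro s r ⟨c, h₁, h₂⟩
      refine h₁.mono ?_
      rintro s' r' ⟨d, h₃, h₄⟩
      refine ⟨d, by simpa using h₃, Locally.pure ⟨r' ≫ c, by simpa using h₄, ?_⟩⟩
      simpa using h₂.precomp r'
    · intro H
      refine Locally.bind (H.mono ?_)
      rintro s r ⟨c, h₁, h₂⟩
      refine h₂.mono ?_
      rintro s' r' ⟨d, h₃, h₄⟩
      refine ⟨d, Locally.pure ⟨r' ≫ c, ?_, by simpa using h₃⟩, by simpa using h₄⟩
      simpa using h₁.precomp r'
  comp_le_comp h h' := by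
    refine RelMor.le_iff.2 fun t a b H => (RelMor.mem_comp _ _ _ _).2 ?_
    refine ((RelMor.mem_comp _ _ _ _).1 H).mono ?_
    rintro s r ⟨c, h₁, h₂⟩
    exact ⟨c, RelMor.le_iff.1 h _ _ h₁, RelMor.le_iff.1 h' _ _ h₂⟩
  join := RelMor.join
  isLUB_join hI f := by
    constructor
    · rintro _ ⟨i, rfl⟩
      exact RelMor.le_iff.2 fun t a b h => (RelMor.mem_join _ _ _ _).2
        (Locally.pure ⟨i, by simpa using h⟩)
    · intro g hg
      refine RelMor.le_iff.2 fun t a b h => ?_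
      refine RelMor.Mem.of_locally (((RelMor.mem_join _ _ _ _).1 h).mono ?_)
      rintro s r ⟨i, hi⟩
      exact RelMor.le_iff.1 (hg ⟨i, rfl⟩) _ _ hi
  comp_join hI g f := by
    refine RelMor.ext_mem fun t a b => ?_
    simp only [RelMor.mem_comp, RelMor.mem_join]
    constructor
    · intro H
      refine Locally.bind (H.mono ?_)
      rintro s r ⟨c, h₁, h₂⟩
      refine h₂.mono ?_
      rintro s' r' ⟨i, hi⟩
      exact ⟨i, Locally.pure ⟨r' ≫ c, by simpa using h₁.precomp r', by simpa using hi⟩⟩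
    · intro H
      refine Locally.bind (H.mono ?_)
      rintro s r ⟨i, h⟩
      refine h.mono ?_
      rintro s' r' ⟨c, h₁, h₂⟩
      exact ⟨c, by simpa using h₁, Locally.pure ⟨i, by simpa using h₂⟩⟩
  join_comp hI f g := by
    refine RelMor.ext_mem fun t a b => ?_
    simp only [RelMor.mem_comp, RelMor.mem_join]
    constructor
    · intro H
      refine Locally.bind (H.mono ?_)
      rintro s r ⟨c, h₁, h₂⟩
      refine h₁.mono ?_
      rintro s' r' ⟨i, hi⟩
      exact ⟨i, Locally.pure ⟨r' ≫ c, by simpa using hi, by simpa using h₂.precomp r'⟩⟩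
    · intro H
      refine Locally.bind (H.mono ?_)
      rintro s r ⟨i, h⟩
      refine h.mono ?_
      rintro s' r' ⟨c, h₁, h₂⟩
      exact ⟨c, Locally.pure ⟨i, by simpa using h₁⟩, by simpa using h₂⟩
  join_inf hI f g := by
    refine RelMor.ext_mem fun t a b => ?_
    refine (RelMor.mem_inf _ _ _ _).trans ?_
    simp only [RelMor.mem_join]
    constructor
    · rintro ⟨h, h'⟩
      refine h.mono ?_
      rintro s r ⟨i, hi⟩
      exact ⟨i, (RelMor.mem_inf _ _ _ _).2 ⟨hi, h'.precomp r⟩⟩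
    · intro H
      refine ⟨H.mono ?_, RelMor.Mem.of_locally (H.mono ?_)⟩
      · rintro s r ⟨i, hi⟩
        exact ⟨i, ((RelMor.mem_inf _ _ _ _).1 hi).1⟩
      · rintro s r ⟨i, hi⟩
        exact ((RelMor.mem_inf _ _ _ _).1 hi).2
  inv := RelMor.inv
  inv_inv f := RelMor.ext_mem fun t a b => by simp only [RelMor.mem_inv]
  inv_id x := RelMor.ext_mem fun t a b => by
    simp only [RelMor.mem_inv, RelMor.mem_diag]
    exact ⟨fun h => h.mono fun _ _ e => e.symm, fun h => h.mono fun _ _ e => e.symm⟩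
  inv_comp f g := RelMor.ext_mem fun t a b => by
    simp only [RelMor.mem_inv, RelMor.mem_comp]
    constructor <;> intro h <;> refine h.mono ?_ <;> rintro s r ⟨c, h₁, h₂⟩ <;>
      exact ⟨c, h₂, h₁⟩
  inv_le_inv h := RelMor.le_iff.2 fun t a b k =>
    (RelMor.mem_inv _ _ _).2 (RelMor.le_iff.1 h _ _ ((RelMor.mem_inv _ _ _).1 k))
  modular f g h := by
    refine RelMor.le_iff.2 fun t a b H => (RelMor.mem_comp _ _ _ _).2 ?_
    obtain ⟨H, H'⟩ := (RelMor.mem_inf _ _ _ _).1 H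
    refine ((RelMor.mem_comp _ _ _ _).1 H).mono ?_
    rintro s r ⟨c, h₁, h₂⟩
    refine ⟨c, h₁, (RelMor.mem_inf _ _ _ _).2 ⟨h₂, (RelMor.mem_comp _ _ _ _).2 ?_⟩⟩
    exact Locally.pure ⟨r ≫ a, (RelMor.mem_inv _ _ _).2 (by simpa using h₁),
      by simpa using H'.precomp r⟩

variable {S} in
theorem RelMor.mem_graph {x y t : C} (f : x ⟶ y) (a : t ⟶ x) (b : t ⟶ y) :
    (RelMor.mk (SpanArr.graph f) : RelMor S x y).Mem a b ↔
      S.Locally t fun _ r => r ≫ a ≫ f = r ≫ b := ExactCompletion.mem_graph _ _ _ _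

variable {S} in
theorem RelMor.graph_comp {x y z : C} (f : x ⟶ y) (g : y ⟶ z) :
    (RelMor.mk (SpanArr.graph (f ≫ g)) : RelMor S x z) =
      (RelMor.mk (SpanArr.graph f)).comp (RelMor.mk (SpanArr.graph g)) := by
  refine RelMor.ext_mem fun t a b => ?_
  rw [RelMor.mem_comp]
  simp only [RelMor.mem_graph]
  constructor
  · intro h
    refine h.mono fun s r e => ⟨r ≫ a ≫ f, Locally.pure (by simp), Locally.pure (by simpa using e)⟩
  · intro h
    refine Locally.bind (h.mono ?_)
    rintro s r ⟨c, h₁, h₂⟩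
    refine Locally.bind (h₁.mono fun s' r' e₁ => ?_)
    refine (h₂.pullback (fun s s' r r' e => by simp [e]) r').mono fun s'' r'' e₂ => ?_
    simp only [Category.assoc] at e₁ e₂ ⊢
    rw [← e₂, ← reassoc_of% e₁]

variable {S} in
theorem RelMor.graph_unit {x y : C} (f : x ⟶ y) :
    (RelMor.mk (SpanArr.diag x) : RelMor S x x) ≤
      (RelMor.mk (SpanArr.graph f)).comp (RelMor.mk (SpanArr.graph f)).inv := by
  refine RelMor.le_iff.2 fun t a b h => (RelMor.mem_comp _ _ _ _).2 ?_
  refine ((RelMor.mem_diag _ _).1 h).mono fun s r e => ⟨r ≫ a ≫ f, ?_, ?_⟩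
  · exact (RelMor.mem_graph _ _ _).2 (Locally.pure (by simp))
  · refine (RelMor.mem_inv _ _ _).2 ((RelMor.mem_graph _ _ _).2 (Locally.pure ?_))
    simp [reassoc_of% e]

variable {S} in
theorem RelMor.graph_counit {x y : C} (f : x ⟶ y) :
    (RelMor.mk (SpanArr.graph f)).inv.comp (RelMor.mk (SpanArr.graph f)) ≤
      (RelMor.mk (SpanArr.diag y) : RelMor S y y) := by
  refine RelMor.le_iff.2 fun t a b h => (RelMor.mem_diag _ _).2 ?_
  refine Locally.bind (((RelMor.mem_comp _ _ _ _).1 h).mono ?_)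
  rintro s r ⟨c, h₁, h₂⟩
  have h₁ := (RelMor.mem_graph _ _ _).1 ((RelMor.mem_inv _ _ _).1 h₁)
  have h₂ := (RelMor.mem_graph _ _ _).1 h₂
  refine Locally.bind (h₁.mono fun s' r' e₁ => ?_)
  refine (h₂.pullback (fun s s' r r' e => by simp [e]) r').mono fun s'' r'' e₂ => ?_
  simp only [Category.assoc] at e₁ e₂ ⊢
  rw [← e₁, ← e₂]

/-- The framed `κ`-ary allegory `Rel_κ(C)`. Its tight maps are the morphisms of `C`. -/
noncomputable def SiteRel : FramedAllegory.{w, u, v, max (w + 1) u v} κ C where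
  toAllegory := relAllegory S
  J f := RelMor.mk (SpanArr.graph f)
  J_id _ := rfl
  J_comp f g := RelMor.graph_comp f g
  isMap_J f := ⟨RelMor.inv (RelMor.mk (SpanArr.graph f)), RelMor.graph_unit f,
    RelMor.graph_counit f⟩

end Rel

/-! ## The exact completion and the spans that represent its morphisms -/

section Ex

variable {κ : ArityClass.{w}} {C : Type u} [Category.{v} C] {S : Topology κ C}

open WeakTopology

/-- The class of a congruence in the site, as a congruence in `Rel_κ(C)`. -/
def SiteCongruence.toRel {X : Fam κ C} (Φ : SiteCongruence S X) : (SiteRel S).Congruence X where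
  arr i j := RelMor.mk (Φ.arr i j)
  refl i := Φ.refl i
  symm i j := Φ.symm i j
  trans i j k := Φ.trans i j k

variable (S) in
/-- The `κ`-ary exact completion of the site `(C, S)`: the category `Map(Mod_κ(Rel_κ(C)))`. -/
abbrev Ex : Type _ := (SiteRel S).Mod.MapCat

/-- The object of the exact completion given by a congruence in the site. -/
def SiteCongruence.toEx {X : Fam κ C} (Φ : SiteCongruence S X) : Ex S := ⟨⟨X, Φ.toRel⟩⟩

theorem RelMor.mem_graph_comp_comp {x y z t v : C} (f : x ⟶ y) (g : v ⟶ z) (φ : RelMor S y z)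
    (a : t ⟶ x) (b : t ⟶ v) :
    ((RelMor.mk (SpanArr.graph f)).comp (φ.comp (RelMor.mk (SpanArr.graph g)).inv)).Mem a b ↔
      φ.Mem (a ≫ f) (b ≫ g) := by
  simp only [RelMor.mem_comp, RelMor.mem_inv, RelMor.mem_graph]
  constructor
  · intro h
    refine RelMor.Mem.of_locally (h.mono ?_)
    rintro s r ⟨c, h₁, h₂⟩
    refine RelMor.Mem.of_locally (h₂.mono ?_)
    rintro s' r' ⟨d, h₃, h₄⟩
    refine RelMor.mem_of_locally_eq (a := r' ≫ c) (b := d) ?_ ?_ h₃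
    · refine (h₁.pullback (fun s s' r r' e => by simp only [Category.assoc] at e ⊢; rw [e]) r').mono fun _ r e => ?_
      simpa using e.symm
    · refine h₄.mono fun _ r e => ?_
      simpa using e.symm
  · intro h
    refine Locally.pure ⟨a ≫ f, Locally.pure (by simp), Locally.pure ⟨b ≫ g, ?_, ?_⟩⟩
    · simpa using h
    · exact Locally.pure (by simp)

theorem siteRel_mem_pullbackCong {X Y : Fam κ C} (F : FunArr X Y) (Ψ : (SiteRel S).Congruence Y)
    (i j : X.ι) {t : C} (a : t ⟶ X.obj i) (b : t ⟶ X.obj j) :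
    RelMor.Mem (S := S) ((FramedAllegory.pullbackCong F Ψ).arr i j) a b ↔
      RelMor.Mem (S := S) (Ψ.arr (F.toFun i) (F.toFun j)) (a ≫ F.hom i) (b ≫ F.hom j) :=
  RelMor.mem_graph_comp_comp _ _ _ _ _

theorem siteRel_covers {u : C} {P : Sink.{w} C u} (h : S.Covers P) : (SiteRel S).Covers P := by
  refine ⟨S.small h, ?_, ?_⟩
  · rintro _ ⟨i, rfl⟩
    exact RelMor.graph_counit (P.map i)
  · intro g hg
    refine RelMor.le_iff.2 fun t a b hab => ?_
    have hab := (RelMor.mem_diag _ _).1 hab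
    refine RelMor.mem_of_locally_eq (a := a) (b := a) (Locally.pure rfl) hab ?_
    obtain ⟨Q, hQ, K⟩ := S.pullback h a
    refine RelMor.Mem.of_locally ⟨Q, hQ, fun i => ?_⟩
    obtain ⟨j, k, e⟩ := K i
    change Q.obj i ⟶ P.obj j at k
    have e : k ≫ P.map j = Q.map i ≫ a := e
    have hj : (RelMor.mk (SpanArr.graph (P.map j))).inv.comp (RelMor.mk (SpanArr.graph (P.map j)))
        ≤ g := hg ⟨j, rfl⟩
    refine RelMor.le_iff.1 hj _ _ ((RelMor.mem_comp _ _ _ _).2 (Locally.pure ⟨k, ?_, ?_⟩))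
    · exact (RelMor.mem_inv _ _ _).2 ((RelMor.mem_graph _ _ _).2 (Locally.pure (by simpa using e)))
    · exact (RelMor.mem_graph _ _ _).2 (Locally.pure (by simpa using e))

/-- A span of functional arrays `X ⇐ W ⇒ Y` with left leg `P` a covering family, such that
`P^* Φ ≲ F^* Ψ`. -/
structure SiteSpan {X Y : Fam κ C} (Φ : SiteCongruence S X) (Ψ : SiteCongruence S Y) where
  apex : Fam κ C
  P : FunArr apex X
  F : FunArr apex Y
  isCovering : S.IsCovering P
  locRefines : (Φ.pullback P).LocRefines (Ψ.pullback F)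

namespace SiteSpan

variable {X Y : Fam κ C} {Φ : SiteCongruence S X} {Ψ : SiteCongruence S Y}

/-- The induced span in the framed allegory `Rel_κ(C)`, whose legs are functional arrays of tight
maps. -/
def toAna (s : SiteSpan Φ Ψ) : (SiteRel S).Ana ⟨X, Φ.toRel⟩ ⟨Y, Ψ.toRel⟩ where
  apex := s.apex
  P := s.P
  F := s.F
  isCovering i := siteRel_covers (s.isCovering i)
  le i j := by
    refine RelMor.le_iff.2 fun t a b h => (siteRel_mem_pullbackCong _ _ _ _ _ _).2 ?_
    have h := (siteRel_mem_pullbackCong _ _ _ _ _ _).1 h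
    exact (mem_pullArr _ _ _ _ _ _).1 (locRefines_iff.1 (s.locRefines i j) _ _
      ((mem_pullArr _ _ _ _ _ _).2 h))

/-- The left leg `P_◆ : P^* Φ ⟶ Φ` in the exact completion. -/
noncomputable def left (s : SiteSpan Φ Ψ) : (⟨s.toAna.dom⟩ : Ex S) ⟶ Φ.toEx := s.toAna.left

/-- The right leg `F_◆ : P^* Φ ⟶ Ψ` in the exact completion. -/
noncomputable def right (s : SiteSpan Φ Ψ) : (⟨s.toAna.dom⟩ : Ex S) ⟶ Ψ.toEx := s.toAna.right

/-- The span `(P, F)` represents the morphism `m : Φ ⟶ Ψ` if `m P_◆ = F_◆`. -/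
def Represents (s : SiteSpan Φ Ψ) (m : Φ.toEx ⟶ Ψ.toEx) : Prop := s.left ≫ m = s.right

/-- There are a covering family `R : U ⇒ X` and functional arrays `H`, `K` with `R = P H = Q K`
such that for all `u` the array `{f_{h(u)} h_u, g_{k(u)} k_u}` factors through
`Ψ(f h(u), g k(u))`. -/
def Rel (s s' : SiteSpan Φ Ψ) : Prop :=
  ∃ (U : Fam κ C) (R : FunArr U X) (H : FunArr U s.apex) (K : FunArr U s'.apex),
    S.IsCovering R ∧ R = H.comp s.P ∧ R = K.comp s'.P ∧
      ∀ u, (Ψ.arr (s.F.toFun (H.toFun u)) (s'.F.toFun (K.toFun u))).Factors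
        (H.hom u ≫ s.F.hom (H.toFun u)) (K.hom u ≫ s'.F.hom (K.toFun u))

end SiteSpan

end Ex

end ExactCompletion

open ExactCompletion

/-! Composites are written in diagrammatic order throughout, as in the code, and `f°` is the
involute of `f`.

Two facts about allegories drive everything. Maps are discretely ordered (`IsMap.eq_of_le`), so an
equality of maps needs only one inequality. And by the modular law a coreflexive `r` with `1 ≤ r φ`
contains `1` (`id_le_of_le_comp`). The second fact turns tabulations into covers: if a map `φ : x →
y` is the join of the `G°F`, then each term equals `(G°G)(G°F)` and `1 ≤ φφ°`, so the coreflexive `⋁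
G°G` absorbs the identity and the `G` cover `x`. Since `G°F ≤ φ`, also `F = Gφ`: on that cover, `φ`
is tight.

For (B), this argument is run on all entries of a map `m` of congruences at once and yields a span
`(P, F)` with `P` covering (`Ana.exists_represents`). The map `P_◆` is invertible because `⋁ P°P =
1` lets the middle of `Φ P° P Φ` be contracted (`Ana.isIso_left`). Two spans are compared over a
common refinement of their covers (`WeaklyTabular.exists_common_refinement`): spans representing the
same `m` satisfy the criterion because `m°m ≤ Θ`, and conversely the criterion gives `m ≤ m'` on a
cover, hence `m = m'` by discreteness.

For (A), tight collages compress a covering family into one weak equivalence: the collage of the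
kernel of a cover of `x` maps to `x` by a tight map that is loosely invertible
(`exists_weakEq_of_covering`). Consequently every map is a fraction of tight maps
(`exists_fraction`), and tight maps that are loosely equal become equal after a weak equivalence
(`exists_weakEq_of_J_eq`). These two statements give both conditions of the calculus of fractions,
and fullness and faithfulness of the comparison functor.

For (C), `Rel_κ(C)` is weakly `κ`-tabular, because an array is tabulated by its own legs
(`siteRel_weaklyTabular`), and its coverings are exactly those of the topology
(`siteRel_isCovering_iff`). So (B) applies. The one difference is that an inequality in `Rel_κ(C)`
only says that spans factor locally; the strict factorization demanded in (C) is obtained by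
refining the cover once more (`SiteSpan.toAna_rel_iff`). -/

namespace ExactCompletion

/-! ### Maps and coreflexives in an allegory. -/

namespace Allegory

variable {κ : ArityClass.{w}} {A : Type u} {𝒜 : Allegory.{w, u, v'} κ A}

theorem comp_mono_left {x y z : A} {f f' : 𝒜.Hom x y} (h : f ≤ f') (g : 𝒜.Hom y z) :
    𝒜.comp f g ≤ 𝒜.comp f' g := 𝒜.comp_le_comp h le_rfl

theorem comp_mono_right {x y z : A} (f : 𝒜.Hom x y) {g g' : 𝒜.Hom y z} (h : g ≤ g') :
    𝒜.comp f g ≤ 𝒜.comp f g' := 𝒜.comp_le_comp le_rfl h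

/-- Maps are left adjoint to their involutes under precomposition. -/
theorem IsMap.inv_comp_le_iff {x y z : A} {f : 𝒜.Hom x y} (hf : 𝒜.IsMap f) {a : 𝒜.Hom x z}
    {b : 𝒜.Hom y z} : 𝒜.comp (𝒜.inv f) a ≤ b ↔ a ≤ 𝒜.comp f b := by
  constructor
  · intro h
    refine le_trans ?_ (comp_mono_right f h)
    rw [← 𝒜.assoc]
    simpa only [𝒜.id_comp] using comp_mono_left hf.inv_adj.1 a
  · intro h
    refine (comp_mono_right _ h).trans ?_
    rw [← 𝒜.assoc]
    simpa only [𝒜.id_comp] using comp_mono_left hf.inv_adj.2 b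

/-- Maps are left adjoint to their involutes under postcomposition. -/
theorem IsMap.comp_le_iff {x y z : A} {f : 𝒜.Hom x y} (hf : 𝒜.IsMap f) {a : 𝒜.Hom z x}
    {b : 𝒜.Hom z y} : 𝒜.comp a f ≤ b ↔ a ≤ 𝒜.comp b (𝒜.inv f) := by
  constructor
  · intro h
    refine le_trans ?_ (comp_mono_left h _)
    rw [𝒜.assoc]
    simpa only [𝒜.comp_id] using comp_mono_right a hf.inv_adj.1
  · intro h
    refine (comp_mono_left h _).trans ?_
    rw [𝒜.assoc]
    simpa only [𝒜.comp_id] using comp_mono_right b hf.inv_adj.2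

/-- Maps are discretely ordered. -/
theorem IsMap.eq_of_le {x y : A} {f g : 𝒜.Hom x y} (hf : 𝒜.IsMap f) (hg : 𝒜.IsMap g)
    (h : f ≤ g) : f = g := by
  refine le_antisymm h ?_
  -- The involution is monotone, so `f° g ≤ g° g ≤ 1`; transposing along `f` gives `g ≤ f`.
  have h₁ : 𝒜.comp (𝒜.inv f) g ≤ 𝒜.id y := (comp_mono_left (𝒜.inv_le_inv h) g).trans hg.inv_adj.2
  simpa only [𝒜.comp_id] using hf.inv_comp_le_iff.1 h₁

/-- A coreflexive `r` with `1 ≤ r φ` is the identity. -/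
theorem id_le_of_le_comp {x : A} {r φ : 𝒜.Hom x x} (hr : r ≤ 𝒜.id x)
    (h : 𝒜.id x ≤ 𝒜.comp r φ) : 𝒜.id x ≤ r := by
  -- In the modular law the meet with `1` replaces `φ` by something below `r°`, and `r° ≤ 1` because
  -- `r ≤ 1`.
  calc 𝒜.id x ≤ 𝒜.comp r φ ⊓ 𝒜.id x := le_inf h le_rfl
    _ ≤ 𝒜.comp r (φ ⊓ 𝒜.comp (𝒜.inv r) (𝒜.id x)) := 𝒜.modular _ _ _
    _ ≤ 𝒜.comp r (𝒜.id x) := by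
      refine comp_mono_right _ (inf_le_right.trans ?_)
      rw [𝒜.comp_id, ← 𝒜.inv_id]
      exact 𝒜.inv_le_inv hr
    _ = r := 𝒜.comp_id r

theorem le_comp_of_id_le_left {x y : A} {r : 𝒜.Hom x x} (h : 𝒜.id x ≤ r) (f : 𝒜.Hom x y) :
    f ≤ 𝒜.comp r f := by simpa only [𝒜.id_comp] using comp_mono_left h f

theorem le_comp_of_id_le_right {x y : A} {r : 𝒜.Hom y y} (h : 𝒜.id y ≤ r) (f : 𝒜.Hom x y) :
    f ≤ 𝒜.comp f r := by simpa only [𝒜.comp_id] using comp_mono_right f h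

theorem MapCat.isIso_of_inverse {X Y : 𝒜.MapCat} (f : X ⟶ Y) (g : 𝒜.Hom Y.obj X.obj)
    (h₁ : 𝒜.comp f.1 g = 𝒜.id _) (h₂ : 𝒜.comp g f.1 = 𝒜.id _) : IsIso f :=
  ⟨⟨g, f.1, h₂.ge, h₁.le⟩, Subtype.ext h₁, Subtype.ext h₂⟩

end Allegory

open Allegory

/-! ### Covering families of tight maps. -/

namespace FramedAllegory

variable {κ : ArityClass.{w}} {T : Type u} [Category.{v} T] {𝔸 : FramedAllegory.{w, u, v, v'} κ T}

theorem inv_J_comp_le_iff {x y z : T} {f : x ⟶ y} {a : 𝔸.Hom x z} {b : 𝔸.Hom y z} :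
    𝔸.comp (𝔸.inv (𝔸.J f)) a ≤ b ↔ a ≤ 𝔸.comp (𝔸.J f) b := (𝔸.isMap_J f).inv_comp_le_iff

theorem comp_J_le_iff {x y z : T} {f : x ⟶ y} {a : 𝔸.Hom z x} {b : 𝔸.Hom z y} :
    𝔸.comp a (𝔸.J f) ≤ b ↔ a ≤ 𝔸.comp b (𝔸.inv (𝔸.J f)) := (𝔸.isMap_J f).comp_le_iff

/-- Counits of tight maps already bound the join by the identity, so only the other inequality
carries information. -/
theorem covers_iff {x : T} {P : Sink.{w} T x} :
    𝔸.Covers P ↔ ∃ h : κ.IsSmall P.ι,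
      𝔸.id x ≤ 𝔸.join h fun i => 𝔸.comp (𝔸.inv (𝔸.J (P.map i))) (𝔸.J (P.map i)) := by
  constructor
  · rintro ⟨h, H⟩
    exact ⟨h, H.2 (𝔸.isLUB_join h _).1⟩
  · rintro ⟨h, H⟩
    refine ⟨h, ?_⟩
    rw [le_antisymm H (join_le h fun i => J_adj_counit _)]
    exact 𝔸.isLUB_join h _

/-- Inequalities out of `x` may be tested on a covering family. -/
theorem Covers.le_of {x t : T} {P : Sink.{w} T x} (hP : 𝔸.Covers P) {φ ψ : 𝔸.Hom x t}
    (h : ∀ i, 𝔸.comp (𝔸.J (P.map i)) φ ≤ 𝔸.comp (𝔸.J (P.map i)) ψ) : φ ≤ ψ := by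
  obtain ⟨hs, H⟩ := covers_iff.1 hP
  refine (le_comp_of_id_le_left H φ).trans ?_
  rw [𝔸.join_comp]
  refine join_le hs fun i => ?_
  rw [𝔸.assoc]
  exact inv_J_comp_le_iff.2 (h i)

/-- This form quantifies over all targets at once and so avoids fibres and the transports they
bring. Conversely, the fibrewise joins of the `P°P` themselves are an admissible choice of `R`. -/
theorem isCovering_iff {V X : Fam κ T} {P : FunArr V X} :
    𝔸.IsCovering P ↔ ∀ R : ∀ x, 𝔸.Hom (X.obj x) (X.obj x),
      (∀ v, 𝔸.comp (𝔸.inv (𝔸.J (P.hom v))) (𝔸.J (P.hom v)) ≤ R (P.toFun v)) →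
      ∀ x, 𝔸.id (X.obj x) ≤ R x := by
  constructor
  · intro hP R hR x
    refine (hP x).2.2 ?_
    rintro _ ⟨⟨v, rfl⟩, rfl⟩
    simpa [FunArr.fiber] using hR v
  · intro H x
    have hs : ∀ x, κ.IsSmall (P.fiber x).ι := ArityClass.isSmall_fiber _ V.small X.small
    refine covers_iff.2 ⟨hs x, H (fun x => 𝔸.join (hs x) fun i =>
      𝔸.comp (𝔸.inv (𝔸.J ((P.fiber x).map i))) (𝔸.J ((P.fiber x).map i))) (fun v => ?_) x⟩
    refine le_trans (le_of_eq ?_) (le_join _ _ ⟨v, rfl⟩)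
    simp [FunArr.fiber]

/-- The counterpart of `Covers.le_of` for families; on a fibre over `P.toFun v` itself the transport
is the identity, so the hypothesis can be stated without it. -/
theorem IsCovering.le_of {V X : Fam κ T} {P : FunArr V X} (hP : 𝔸.IsCovering P)
    {t : X.ι → T} {φ ψ : ∀ x, 𝔸.Hom (X.obj x) (t x)}
    (h : ∀ v, 𝔸.comp (𝔸.J (P.hom v)) (φ (P.toFun v)) ≤ 𝔸.comp (𝔸.J (P.hom v)) (ψ (P.toFun v)))
    (x : X.ι) : φ x ≤ ψ x := by
  refine (hP x).le_of ?_
  rintro ⟨v, rfl⟩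
  change 𝔸.comp (𝔸.J (P.hom v ≫ 𝟙 _)) _ ≤ 𝔸.comp (𝔸.J (P.hom v ≫ 𝟙 _)) _
  rw [Category.comp_id]
  exact h v

/-- From `1 ≤ G G°` one gets `G° ≤ G° G G°`. This splits the image coreflexive `G°G` off a tabulated
morphism, as needed to show that left legs cover. -/
theorem inv_J_comp_le_kernel {x y z : T} (G : z ⟶ x) (f : 𝔸.Hom z y) :
    𝔸.comp (𝔸.inv (𝔸.J G)) f ≤
      𝔸.comp (𝔸.comp (𝔸.inv (𝔸.J G)) (𝔸.J G)) (𝔸.comp (𝔸.inv (𝔸.J G)) f) := by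
  rw [𝔸.assoc]
  exact comp_mono_right _ (inv_J_comp_le_iff.1 le_rfl)

end FramedAllegory

end ExactCompletion

/-! ### Common refinements of covering families. -/

namespace ExactCompletion

open Allegory

theorem FunArr.ext_of_hom {κ : ArityClass.{w}} {C : Type u} [Category.{v} C] {X Y : Fam κ C}
    {F G : FunArr X Y} (h : ∀ i, ∃ e : F.toFun i = G.toFun i,
      F.hom i ≫ eqToHom (congrArg Y.obj e) = G.hom i) : F = G := by
  obtain ⟨f, p⟩ := F
  obtain ⟨g, q⟩ := G
  obtain rfl : f = g := funext fun i => (h i).1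
  obtain rfl : p = q := funext fun i => by
    obtain ⟨_, e⟩ := h i
    simpa using e
  rfl

namespace FramedAllegory

variable {κ : ArityClass.{w}} {T : Type u} [Category.{v} T] {𝔸 : FramedAllegory.{w, u, v, v'} κ T}

/-- Covering families of the same family have a common refinement, commuting strictly. -/
theorem WeaklyTabular.exists_common_refinement (hT : 𝔸.WeaklyTabular) {V V' X : Fam κ T}
    {P : FunArr V X} {P' : FunArr V' X} (hP : 𝔸.IsCovering P) (hP' : 𝔸.IsCovering P') :
    ∃ (U : Fam κ T) (S : FunArr U V) (S' : FunArr U V'),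
      S.comp P = S'.comp P' ∧ 𝔸.IsCovering (S.comp P) := by
  -- `k` is `P'` with its target transported to that of `P`; keeping it opaque lets the transport be
  -- dealt with only at the end.
  obtain ⟨k, hk⟩ : ∃ k : ∀ v (b : {v' // P'.toFun v' = P.toFun v}),
      V'.obj b.1 ⟶ X.obj (P.toFun v),
      ∀ v b, k v b = P'.hom b.1 ≫ eqToHom (congrArg X.obj b.2) := ⟨_, fun _ _ => rfl⟩
  -- The relation `P k°` plays the role of the pullback of `P` and `P'`; its tabulation supplies the
  -- missing objects.
  choose Z F G hφ using fun v (b : {v' // P'.toFun v' = P.toFun v}) =>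
    hT.exists_tabulation (𝔸.comp (𝔸.J (P.hom v)) (𝔸.inv (𝔸.J (k v b))))
  -- The square commutes only loosely: transposing `G°F ≤ P k°` gives `F k ≤ G P`, and maps are
  -- discretely ordered. A further cover `Q` from weak tabularity makes it commute strictly.
  have hJ : ∀ v b z, 𝔸.J (G v b z ≫ P.hom v) = 𝔸.J (F v b z ≫ k v b) := by
    intro v b z
    refine ((𝔸.isMap_J _).eq_of_le (𝔸.isMap_J _) ?_).symm
    rw [𝔸.J_comp, 𝔸.J_comp, comp_J_le_iff, 𝔸.assoc, ← inv_J_comp_le_iff, hφ v b]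
    exact le_join (Z v b).small (fun z => 𝔸.comp (𝔸.inv (𝔸.J (G v b z))) (𝔸.J (F v b z))) z
  choose Q hQ hGF using fun v b z => hT.exists_cover _ _ (hJ v b z)
  refine ⟨⟨Σ (v : V.ι) (b : {v' // P'.toFun v' = P.toFun v}) (z : (Z v b).ι), (Q v b z).ι, ?_,
      fun u => (Q u.1 u.2.1 u.2.2.1).obj u.2.2.2⟩,
    ⟨fun u => u.1, fun u => (Q u.1 u.2.1 u.2.2.1).map u.2.2.2 ≫ G u.1 u.2.1 u.2.2.1⟩,
    ⟨fun u => u.2.1.1, fun u => (Q u.1 u.2.1 u.2.2.1).map u.2.2.2 ≫ F u.1 u.2.1 u.2.2.1⟩,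
    ?_, ?_⟩
  · exact ArityClass.isSmall_sigma V.small fun v =>
      ArityClass.isSmall_sigma (ArityClass.isSmall_fiber _ V'.small X.small _) fun b =>
        ArityClass.isSmall_sigma (Z v b).small fun z => (hQ v b z).1
  · refine (FunArr.ext_of_hom ?_).symm
    rintro ⟨v, b, z, q⟩
    refine ⟨b.2, ?_⟩
    simpa [hk, FunArr.comp] using (hGF v b z q).symm
  · refine isCovering_iff.2 fun R hR => hP.le_of (φ := fun x => 𝔸.id (X.obj x)) (ψ := R) fun v => ?_
    rw [𝔸.comp_id]
    -- Inserting the cover `P'` gives `P ≤ ⋁ P k°k = ⋁ G°F k = ⋁ G°G P`, and each term is bounded by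
    -- `P R` after testing on `Q`.
    obtain ⟨hs, h₁⟩ := covers_iff.1 (hP' (P.toFun v))
    refine (le_comp_of_id_le_right h₁ _).trans ?_
    rw [𝔸.comp_join]
    refine join_le hs fun (b : {v' // P'.toFun v' = P.toFun v}) => ?_
    change 𝔸.comp (𝔸.J (P.hom v)) (𝔸.comp (𝔸.inv (𝔸.J (P'.hom b.1 ≫ eqToHom _)))
      (𝔸.J (P'.hom b.1 ≫ eqToHom _))) ≤ _
    rw [← hk, ← 𝔸.assoc, hφ, 𝔸.join_comp]
    refine join_le _ fun z => ?_
    rw [𝔸.assoc, ← 𝔸.J_comp, ← hJ, inv_J_comp_le_iff]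
    refine (hQ _ _ z).le_of fun q => ?_
    have h := inv_J_comp_le_iff.1 (hR ⟨v, b, z, q⟩)
    simp only [FunArr.comp, Category.assoc, 𝔸.J_comp, 𝔸.assoc] at h ⊢
    exact h

/-! ### Maps of congruences and the spans that represent them. -/

section Loose

variable {Φ Θ : 𝔸.ModObj}

/-- The array of morphisms underlying a map of congruences. -/
def looseArr (m : (⟨Φ⟩ : 𝔸.Mod.MapCat) ⟶ ⟨Θ⟩) (i : Φ.fam.ι) (j : Θ.fam.ι) :
    𝔸.Hom (Φ.fam.obj i) (Θ.fam.obj j) := (show ModHom Φ Θ from m.1).arr i j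

/-- Discreteness of maps in `Mod_κ(𝒜)`, whose order is entrywise. -/
theorem eq_of_looseArr_le {m m' : (⟨Φ⟩ : 𝔸.Mod.MapCat) ⟶ ⟨Θ⟩}
    (h : ∀ i j, looseArr m i j ≤ looseArr m' i j) : m = m' :=
  Subtype.ext (IsMap.eq_of_le m.2 m'.2 h)

theorem comp_looseArr_le (m : (⟨Φ⟩ : 𝔸.Mod.MapCat) ⟶ ⟨Θ⟩) (i i' : Φ.fam.ι) (j : Θ.fam.ι) :
    𝔸.comp (Φ.cong.arr i i') (looseArr m i' j) ≤ looseArr m i j :=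
  (show ModHom Φ Θ from m.1).left i i' j

theorem looseArr_comp_le (m : (⟨Φ⟩ : 𝔸.Mod.MapCat) ⟶ ⟨Θ⟩) (i : Φ.fam.ι) (j j' : Θ.fam.ι) :
    𝔸.comp (looseArr m i j) (Θ.cong.arr j j') ≤ looseArr m i j' :=
  (show ModHom Φ Θ from m.1).right i j j'

/-- The unit of `m ⊣ m°` in `Mod_κ(𝒜)` bounds `Φ`, the identity there, and `Φ(i,i)` contains the
identity of `𝒜`. -/
theorem looseArr_unit (m : (⟨Φ⟩ : 𝔸.Mod.MapCat) ⟶ ⟨Θ⟩) (i : Φ.fam.ι) :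
    𝔸.id _ ≤ 𝔸.join Θ.fam.small fun j =>
      𝔸.comp (looseArr m i j) (𝔸.inv (looseArr m i j)) :=
  (Φ.cong.refl i).trans (m.2.inv_adj.1 i i)

theorem looseArr_counit (m : (⟨Φ⟩ : 𝔸.Mod.MapCat) ⟶ ⟨Θ⟩) (i : Φ.fam.ι) (j j' : Θ.fam.ι) :
    𝔸.comp (𝔸.inv (looseArr m i j)) (looseArr m i j') ≤ Θ.cong.arr j j' :=
  (le_join Φ.fam.small (fun i => 𝔸.comp (𝔸.inv (looseArr m i j)) (looseArr m i j')) i).trans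
    (m.2.inv_adj.2 j j')

namespace Ana

/-- The entry is `⋁ P Φ m`, and `Φ` acts on `m` as an identity, so the join collapses. -/
theorem looseArr_left_comp (s : Ana Φ Θ) (m : (⟨Φ⟩ : 𝔸.Mod.MapCat) ⟶ ⟨Θ⟩) (i : s.apex.ι)
    (j : Θ.fam.ι) : looseArr (s.left ≫ m) i j =
      𝔸.comp (𝔸.J (s.P.hom i)) (looseArr m (s.P.toFun i) j) := by
  change 𝔸.join Φ.fam.small (fun k => 𝔸.comp (𝔸.comp (𝔸.J (s.P.hom i))
    (Φ.cong.arr (s.P.toFun i) k)) (looseArr m k j)) = _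
  simp only [𝔸.assoc, ← 𝔸.comp_join]
  refine congrArg (𝔸.comp _) (le_antisymm (join_le _ fun k => comp_looseArr_le m _ _ _) ?_)
  exact (le_comp_of_id_le_left (Φ.cong.refl _) _).trans
    (le_join Φ.fam.small (fun k => 𝔸.comp (Φ.cong.arr (s.P.toFun i) k) (looseArr m k j)) _)

theorem represents_iff {s : Ana Φ Θ} {m : (⟨Φ⟩ : 𝔸.Mod.MapCat) ⟶ ⟨Θ⟩} :
    s.Represents m ↔ ∀ i j, 𝔸.comp (𝔸.J (s.P.hom i)) (looseArr m (s.P.toFun i) j) =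
      𝔸.comp (𝔸.J (s.F.hom i)) (Θ.cong.arr (s.F.toFun i) j) := by
  constructor
  · intro h i j
    rw [← looseArr_left_comp, show s.left ≫ m = s.right from h]
    rfl
  · intro h
    exact eq_of_looseArr_le fun i j => ((looseArr_left_comp s m i j).trans (h i j)).le

/-- The inverse is the array `Φ P°`. One composite is `P Φ Φ P° = P Φ P°` because `Φ` is idempotent;
the other is `⋁ Φ P°P Φ = Φ` because `P` covers. -/
theorem isIso_left (s : Ana Φ Θ) : IsIso s.left := by
  have hr : ∀ (j : Φ.fam.ι) (i i' : s.apex.ι),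
      𝔸.comp (𝔸.comp (Φ.cong.arr j (s.P.toFun i)) (𝔸.inv (𝔸.J (s.P.hom i))))
        ((pullbackCong s.P Φ.cong).arr i i') ≤
      𝔸.comp (Φ.cong.arr j (s.P.toFun i')) (𝔸.inv (𝔸.J (s.P.hom i'))) := by
    intro j i i'
    rw [𝔸.assoc]
    refine (comp_mono_right _ (inv_J_comp_le_iff.2 le_rfl)).trans ?_
    rw [← 𝔸.assoc]
    exact comp_mono_left (Φ.cong.trans _ _ _) _
  refine MapCat.isIso_of_inverse s.left
    ((⟨fun j i => 𝔸.comp (Φ.cong.arr j (s.P.toFun i)) (𝔸.inv (𝔸.J (s.P.hom i))), ?_, hr⟩ :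
      ModHom Φ s.dom)) ?_ ?_
  · intro j j' i
    rw [← 𝔸.assoc]
    exact comp_mono_left (Φ.cong.trans _ _ _) _
  · refine ModHom.ext (funext fun i => funext fun i' => ?_)
    change 𝔸.join Φ.fam.small (fun j => 𝔸.comp (𝔸.comp (𝔸.J (s.P.hom i))
      (Φ.cong.arr (s.P.toFun i) j)) (𝔸.comp (Φ.cong.arr j (s.P.toFun i'))
      (𝔸.inv (𝔸.J (s.P.hom i'))))) = 𝔸.comp (𝔸.J (s.P.hom i))
        (𝔸.comp (Φ.cong.arr (s.P.toFun i) (s.P.toFun i')) (𝔸.inv (𝔸.J (s.P.hom i'))))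
    simp only [𝔸.assoc, ← 𝔸.comp_join]
    simp only [← 𝔸.assoc, ← 𝔸.join_comp]
    refine congrArg (fun x => 𝔸.comp (𝔸.comp _ x) _)
      (le_antisymm (join_le _ fun j => Φ.cong.trans _ _ _) ?_)
    exact (le_comp_of_id_le_left (Φ.cong.refl _) _).trans (le_join Φ.fam.small (fun j => 𝔸.comp
      (Φ.cong.arr (s.P.toFun i) j) (Φ.cong.arr j (s.P.toFun i'))) _)
  · refine ModHom.ext (funext fun j => funext fun j' => ?_)
    change 𝔸.join s.apex.small (fun i => 𝔸.comp (𝔸.comp (Φ.cong.arr j (s.P.toFun i))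
      (𝔸.inv (𝔸.J (s.P.hom i)))) (𝔸.comp (𝔸.J (s.P.hom i)) (Φ.cong.arr (s.P.toFun i) j'))) =
        Φ.cong.arr j j'
    refine le_antisymm (join_le _ fun i => ?_) ?_
    · rw [𝔸.assoc]
      exact (comp_mono_right _ (inv_J_comp_le_iff.2 le_rfl)).trans (Φ.cong.trans _ _ _)
    -- Only here is covering used. When tested at `i`, the `i`-th term of the join suffices, since
    -- `1 ≤ Φ` at the image of `i`.
    · refine s.isCovering.le_of (φ := fun j => Φ.cong.arr j j') (ψ := fun j => 𝔸.join s.apex.small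
        (fun i => 𝔸.comp (𝔸.comp (Φ.cong.arr j (s.P.toFun i)) (𝔸.inv (𝔸.J (s.P.hom i))))
          (𝔸.comp (𝔸.J (s.P.hom i)) (Φ.cong.arr (s.P.toFun i) j')))) (fun i => ?_) j
      rw [← inv_J_comp_le_iff]
      refine le_trans ?_ (le_join s.apex.small (fun k => 𝔸.comp (𝔸.comp (Φ.cong.arr (s.P.toFun i)
        (s.P.toFun k)) (𝔸.inv (𝔸.J (s.P.hom k)))) (𝔸.comp (𝔸.J (s.P.hom k))
          (Φ.cong.arr (s.P.toFun k) j'))) i)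
      exact comp_mono_left (le_comp_of_id_le_left (Φ.cong.refl _) _) _

/-- Tabulate every entry `m(i,j)` as `⋁ G°F` and collect all the `G` into `P` and all the `F` into
the right leg. -/
theorem exists_represents (hT : 𝔸.WeaklyTabular) (m : (⟨Φ⟩ : 𝔸.Mod.MapCat) ⟶ ⟨Θ⟩) :
    ∃ s : Ana Φ Θ, s.Represents m := by
  choose Z F G hm using fun i j => hT.exists_tabulation (looseArr m i j)
  have hGF : ∀ i j z, 𝔸.comp (𝔸.inv (𝔸.J (G i j z))) (𝔸.J (F i j z)) ≤ looseArr m i j := by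
    intro i j z
    rw [hm i j]
    exact le_join (Z i j).small
      (fun z => 𝔸.comp (𝔸.inv (𝔸.J (G i j z))) (𝔸.J (F i j z))) z
  have hF : ∀ i j z, 𝔸.J (F i j z) ≤ 𝔸.comp (𝔸.J (G i j z)) (looseArr m i j) :=
    fun i j z => inv_J_comp_le_iff.1 (hGF i j z)
  have hFG : ∀ i j z, 𝔸.comp (𝔸.inv (𝔸.J (F i j z))) (𝔸.J (G i j z)) ≤
      𝔸.inv (looseArr m i j) := by
    intro i j z
    simpa only [𝔸.inv_comp, 𝔸.inv_inv] using 𝔸.inv_le_inv (hGF i j z)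
  let W : Fam κ T := ⟨Σ (i : Φ.fam.ι) (j : Θ.fam.ι), (Z i j).ι,
    ArityClass.isSmall_sigma Φ.fam.small fun i => ArityClass.isSmall_sigma Θ.fam.small fun j =>
      (Z i j).small, fun k => (Z k.1 k.2.1).obj k.2.2⟩
  let s : Ana Φ Θ :=
    { apex := W
      P := ⟨fun k => k.1, fun k => G k.1 k.2.1 k.2.2⟩
      F := ⟨fun k => k.2.1, fun k => F k.1 k.2.1 k.2.2⟩
      isCovering := by
        refine isCovering_iff.2 fun R hR i => ?_
        -- The meet with `1` makes `R i` coreflexive. It remains to see `1 ≤ (R i ⊓ 1)(⋁ m m°)`: the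
        -- unit gives `1 ≤ ⋁ m m°`, and `m ≤ (R i ⊓ 1) m` since each `G°F` lies below `(G°G)(G°F)`.
        refine (id_le_of_le_comp (r := R i ⊓ 𝔸.id _) inf_le_right
          (φ := 𝔸.join Θ.fam.small fun j =>
            𝔸.comp (looseArr m i j) (𝔸.inv (looseArr m i j))) ?_).trans inf_le_left
        rw [𝔸.comp_join]
        refine (looseArr_unit m i).trans (join_mono _ fun j => ?_)
        rw [← 𝔸.assoc]
        refine comp_mono_left ?_ _
        conv_lhs => rw [hm i j]
        refine join_le _ fun z => (inv_J_comp_le_kernel _ _).trans ?_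
        exact 𝔸.comp_le_comp (le_inf (hR ⟨i, j, z⟩) (J_adj_counit _)) (hGF i j z)
      le := by
        rintro ⟨i, j, z⟩ ⟨i', j', z'⟩
        change 𝔸.comp (𝔸.J (G i j z)) (𝔸.comp (Φ.cong.arr i i') (𝔸.inv (𝔸.J (G i' j' z')))) ≤
          𝔸.comp (𝔸.J (F i j z)) (𝔸.comp (Θ.cong.arr j j') (𝔸.inv (𝔸.J (F i' j' z'))))
        -- After transposing both legs, the claim is `F°G Φ G'°F' ≤ Θ`, which follows from `m° Φ m ≤
        -- m°m ≤ Θ`.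
        rw [← inv_J_comp_le_iff, ← comp_J_le_iff]
        calc _ = 𝔸.comp (𝔸.comp (𝔸.inv (𝔸.J (F i j z))) (𝔸.J (G i j z)))
              (𝔸.comp (Φ.cong.arr i i')
                (𝔸.comp (𝔸.inv (𝔸.J (G i' j' z'))) (𝔸.J (F i' j' z')))) := by
              simp only [𝔸.assoc]
          _ ≤ 𝔸.comp (𝔸.inv (looseArr m i j)) (𝔸.comp (Φ.cong.arr i i') (looseArr m i' j')) :=
              𝔸.comp_le_comp (hFG _ _ _) (comp_mono_right _ (hGF _ _ _))
          _ ≤ 𝔸.comp (𝔸.inv (looseArr m i j)) (looseArr m i j') :=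
              comp_mono_right _ (comp_looseArr_le _ _ _ _)
          _ ≤ _ := looseArr_counit _ _ _ _ }
  -- The easy direction is `F Θ ≤ G m Θ ≤ G m`; the reverse comes free from discreteness.
  refine ⟨s, Eq.symm (eq_of_looseArr_le ?_)⟩
  rintro ⟨i, j, z⟩ j'
  rw [looseArr_left_comp]
  change 𝔸.comp (𝔸.J (F i j z)) (Θ.cong.arr j j') ≤ 𝔸.comp (𝔸.J (G i j z)) (looseArr m i j')
  refine (comp_mono_left (hF i j z) _).trans ?_
  rw [𝔸.assoc]
  exact comp_mono_right _ (looseArr_comp_le _ _ _ _)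

/-- On the common cover, `m` and `m'` restrict to the two right legs followed by `Θ`. Transposed,
the criterion says that the first leg is at most the second followed by `Θ`, and `Θ` absorbs itself;
so `m ≤ m'`. -/
theorem eq_of_rel {s s' : Ana Φ Θ} {m m' : (⟨Φ⟩ : 𝔸.Mod.MapCat) ⟶ ⟨Θ⟩} (hm : s.Represents m)
    (hm' : s'.Represents m') (h : s.Rel s') : m = m' := by
  obtain ⟨U, S, S', e, hS, hΘ⟩ := h
  rw [represents_iff] at hm hm'
  refine eq_of_looseArr_le fun i j => hS.le_of (φ := fun i => looseArr m i j)
    (ψ := fun i => looseArr m' i j) (fun k => ?_) i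
  have h₁ : 𝔸.comp (𝔸.J ((S.comp s.P).hom k)) (looseArr m ((S.comp s.P).toFun k) j) =
      𝔸.comp (𝔸.J ((S.comp s.F).hom k)) (Θ.cong.arr ((S.comp s.F).toFun k) j) := by
    simp only [FunArr.comp, 𝔸.J_comp, 𝔸.assoc, hm]
  have h₂ : 𝔸.comp (𝔸.J ((S'.comp s'.P).hom k)) (looseArr m' ((S'.comp s'.P).toFun k) j) =
      𝔸.comp (𝔸.J ((S'.comp s'.F).hom k)) (Θ.cong.arr ((S'.comp s'.F).toFun k) j) := by
    simp only [FunArr.comp, 𝔸.J_comp, 𝔸.assoc, hm']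
  rw [← e] at h₂
  rw [h₁, h₂]
  refine (comp_mono_left (inv_J_comp_le_iff.1 (hΘ k)) _).trans ?_
  rw [𝔸.assoc]
  exact comp_mono_right _ (Θ.cong.trans _ _ _)

theorem rel_of_represents (hT : 𝔸.WeaklyTabular) {s s' : Ana Φ Θ}
    {m : (⟨Φ⟩ : 𝔸.Mod.MapCat) ⟶ ⟨Θ⟩} (hm : s.Represents m) (hm' : s'.Represents m) :
    s.Rel s' := by
  obtain ⟨U, S, S', e, hS⟩ := hT.exists_common_refinement s.isCovering s'.isCovering
  refine ⟨U, S, S', e, hS, fun k => ?_⟩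
  -- Both right legs lie below the same cover followed by `m`. Composing the involute of one with
  -- the other therefore gives at most `m° (cover)°(cover) m ≤ m°m ≤ Θ`.
  have aux : ∀ (s : Ana Φ Θ) (_ : s.Represents m) (S : FunArr U s.apex),
      𝔸.J ((S.comp s.F).hom k) ≤ 𝔸.comp (𝔸.J ((S.comp s.P).hom k))
        (looseArr m ((S.comp s.P).toFun k) ((S.comp s.F).toFun k)) := by
    intro s hm S
    rw [represents_iff] at hm
    simp only [FunArr.comp, 𝔸.J_comp, 𝔸.assoc, hm]
    exact comp_mono_right _ (le_comp_of_id_le_right (Θ.cong.refl _) _)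
  have h₁ := aux s hm S
  have h₂ := 𝔸.inv_le_inv (aux s' hm' S')
  rw [← e, 𝔸.inv_comp] at h₂
  refine (𝔸.comp_le_comp h₂ h₁).trans ?_
  rw [𝔸.assoc]
  exact (comp_mono_right _ (inv_J_comp_le_iff.2 le_rfl)).trans (looseArr_counit _ _ _ _)

theorem eq_iff_rel (hT : 𝔸.WeaklyTabular) {s s' : Ana Φ Θ}
    {m m' : (⟨Φ⟩ : 𝔸.Mod.MapCat) ⟶ ⟨Θ⟩} (hm : s.Represents m) (hm' : s'.Represents m') :
    m = m' ↔ s.Rel s' := by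
  refine ⟨?_, eq_of_rel hm hm'⟩
  rintro rfl
  exact rel_of_represents hT hm hm'

end Ana

end Loose

end FramedAllegory

end ExactCompletion

namespace ExactCompletion

open Allegory

/-! ### Weak equivalences, right fractions and the localization. -/

namespace FramedAllegory

variable {κ : ArityClass.{w}} {T : Type u} [Category.{v} T] {𝔸 : FramedAllegory.{w, u, v, v'} κ T}

/-- The kernel congruence of a cocone of tight maps. -/
def kernel {X : Fam κ T} {x : T} (F : ∀ i, X.obj i ⟶ x) : 𝔸.Congruence X where
  arr i j := 𝔸.comp (𝔸.J (F i)) (𝔸.inv (𝔸.J (F j)))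
  refl i := J_adj_unit _
  symm i j := by rw [𝔸.inv_comp, 𝔸.inv_inv]
  trans i j k := by
    rw [𝔸.assoc]
    exact comp_mono_right _ (inv_J_comp_le_iff.2 le_rfl)

/-- A covering cocone of tight maps factors through a weak equivalence from the tight collage of
its kernel. -/
theorem exists_weakEq_of_covering (hA : 𝔸.HasTightCollages) {X : Fam κ T} {x : T}
    (G : ∀ i, X.obj i ⟶ x)
    (hG : 𝔸.id x ≤ 𝔸.join X.small fun i => 𝔸.comp (𝔸.inv (𝔸.J (G i))) (𝔸.J (G i))) :
    ∃ (z : T) (E : ∀ i, X.obj i ⟶ z) (h : z ⟶ x), 𝔸.IsTightCollage (kernel (𝔸 := 𝔸) G) E ∧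
      𝔸.weakEq h ∧ ∀ i, E i ≫ h = G i := by
  obtain ⟨z, E, hE⟩ := hA (kernel (𝔸 := 𝔸) G)
  -- `G` is a cocone under its own kernel, hence factors loosely through the collage; as `G` is
  -- tight, the tight universal property lifts the factorization to a tight `h`.
  obtain ⟨χ, hχ⟩ := hE.isCollage.exists_desc (fun i => 𝔸.J (G i)) fun i j => by
    change 𝔸.comp (𝔸.comp _ _) _ ≤ _
    rw [𝔸.assoc]
    simpa only [𝔸.comp_id] using comp_mono_right (𝔸.J (G i)) (J_adj_counit (G j))
  obtain ⟨h, ⟨rfl, h₂⟩, -⟩ := hE.bijective χ G fun i => (hχ i).symm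
  refine ⟨z, E, h, hE, ?_, h₂⟩
  have hc : ∀ i j, 𝔸.comp (𝔸.comp (𝔸.J (G i)) (𝔸.inv (𝔸.J (G j)))) (𝔸.J (E j)) ≤ 𝔸.J (E i) :=
    hE.isCollage.cocone
  -- The inverse of `h` is `⋁ G°E`. That `h` followed by it is `1` is tested on the collage legs,
  -- where it reads `⋁ G_i G_j° E_j = E_i`; the other composite is `⋁ G°G = 1`.
  have e : ∀ i, 𝔸.comp (𝔸.J (E i)) (𝔸.comp (𝔸.J h) (𝔸.join X.small fun j =>
      𝔸.comp (𝔸.inv (𝔸.J (G j))) (𝔸.J (E j)))) = 𝔸.comp (𝔸.J (E i)) (𝔸.id z) := by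
    intro i
    rw [← 𝔸.assoc, ← 𝔸.J_comp, h₂, 𝔸.comp_id, 𝔸.comp_join]
    refine le_antisymm (join_le _ fun j => ?_) ?_
    · rw [← 𝔸.assoc]
      exact hc i j
    · exact (inv_J_comp_le_iff.1 le_rfl).trans
        (le_join X.small (fun j => 𝔸.comp (𝔸.J (G i)) (𝔸.comp (𝔸.inv (𝔸.J (G j))) (𝔸.J (E j)))) i)
  refine ⟨𝔸.join X.small fun j => 𝔸.comp (𝔸.inv (𝔸.J (G j))) (𝔸.J (E j)),
    le_antisymm (hE.isCollage.le_of_le _ _ fun i => (e i).le)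
      (hE.isCollage.le_of_le _ _ fun i => (e i).ge), ?_⟩
  simp only [𝔸.join_comp, 𝔸.assoc, ← 𝔸.J_comp, h₂]
  exact le_antisymm (join_le _ fun i => J_adj_counit _) hG

/-- The two maps agree on a cover, which factors through a weak equivalence `t` out of a tight
collage. Then `t ≫ f` and `t ≫ g` have the same loose map and the same restriction along the
collage, so uniqueness for tight collages identifies them. -/
theorem exists_weakEq_of_J_eq (hT : 𝔸.WeaklyTabular) (hA : 𝔸.HasTightCollages) {x y : T}
    (f g : x ⟶ y) (h : 𝔸.J f = 𝔸.J g) : ∃ (z : T) (t : z ⟶ x), 𝔸.weakEq t ∧ t ≫ f = t ≫ g := by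
  obtain ⟨P, hP, e⟩ := hT.exists_cover f g h
  obtain ⟨hs, h₁⟩ := covers_iff.1 hP
  obtain ⟨z, E, t, hE, ht, hEt⟩ := exists_weakEq_of_covering hA (X := ⟨P.ι, hs, P.obj⟩) P.map h₁
  refine ⟨z, t, ht, ?_⟩
  refine (hE.bijective (𝔸.J (t ≫ f)) (fun i => P.map i ≫ f) fun i => ?_).unique
    ⟨rfl, fun i => ?_⟩ ⟨?_, fun i => ?_⟩
  · rw [← 𝔸.J_comp, ← Category.assoc, hEt]
  · rw [← Category.assoc, hEt]
  · rw [𝔸.J_comp, 𝔸.J_comp, h]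
  · rw [← Category.assoc, hEt, e i]

/-- Every map is a fraction of tight maps. -/
theorem exists_fraction (hT : 𝔸.WeaklyTabular) (hA : 𝔸.HasTightCollages) {x y : T}
    {φ : 𝔸.Hom x y} (hφ : 𝔸.IsMap φ) :
    ∃ (z : T) (s : z ⟶ x) (g : z ⟶ y), 𝔸.weakEq s ∧ 𝔸.J g = 𝔸.comp (𝔸.J s) φ := by
  obtain ⟨Z, F, G, e⟩ := hT.exists_tabulation φ
  have hGF : ∀ i, 𝔸.comp (𝔸.inv (𝔸.J (G i))) (𝔸.J (F i)) ≤ φ := fun i => by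
    rw [e]
    exact le_join Z.small (fun i => 𝔸.comp (𝔸.inv (𝔸.J (G i))) (𝔸.J (F i))) i
  have hF : ∀ i, 𝔸.J (F i) = 𝔸.comp (𝔸.J (G i)) φ := fun i =>
    (𝔸.isMap_J _).eq_of_le ((𝔸.isMap_J _).comp hφ) (inv_J_comp_le_iff.1 (hGF i))
  -- Since `F = Gφ`, the tabulation reads `φ = (⋁ G°G) φ`. Hence `1 ≤ φφ° = (⋁ G°G)(φφ°)`, and the
  -- coreflexive `⋁ G°G` is everything.
  have hG : 𝔸.id x ≤ 𝔸.join Z.small fun i => 𝔸.comp (𝔸.inv (𝔸.J (G i))) (𝔸.J (G i)) := by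
    refine id_le_of_le_comp (φ := 𝔸.comp φ (𝔸.inv φ)) (join_le _ fun i => J_adj_counit _) ?_
    rw [← 𝔸.assoc]
    refine hφ.inv_adj.1.trans (comp_mono_left ?_ _)
    conv_lhs => rw [e]
    rw [𝔸.join_comp]
    refine join_mono _ fun i => ?_
    rw [𝔸.assoc, hF]
  obtain ⟨z, E, s, hE, hs, hEs⟩ := exists_weakEq_of_covering hA G hG
  obtain ⟨g, ⟨hg, -⟩, -⟩ := hE.bijective (𝔸.comp (𝔸.J s) φ) F fun i => by
    rw [hF, ← 𝔸.assoc, ← 𝔸.J_comp, hEs]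
  exact ⟨z, s, g, hs, hg⟩

theorem weakEq_isInvertedBy (𝔸 : FramedAllegory.{w, u, v, v'} κ T) :
    𝔸.weakEq.IsInvertedBy 𝔸.toMap := by
  rintro x y f ⟨g, h₁, h₂⟩
  exact MapCat.isIso_of_inverse _ g h₁ h₂

theorem weakEq_of_isIso {x y : T} (f : x ⟶ y) (h : IsIso (𝔸.toMap.map f)) : 𝔸.weakEq f :=
  ⟨(inv (𝔸.toMap.map f)).1, congrArg Subtype.val (IsIso.hom_inv_id (𝔸.toMap.map f)),
    congrArg Subtype.val (IsIso.inv_hom_id (𝔸.toMap.map f))⟩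

theorem weakEq_iff_isIso {x y : T} (f : x ⟶ y) : 𝔸.weakEq f ↔ IsIso (𝔸.toMap.map f) :=
  ⟨weakEq_isInvertedBy 𝔸 f, weakEq_of_isIso f⟩

theorem weakEq_isMultiplicative (𝔸 : FramedAllegory.{w, u, v, v'} κ T) :
    𝔸.weakEq.IsMultiplicative where
  id_mem x := (weakEq_iff_isIso _).2 (by rw [𝔸.toMap.map_id]; infer_instance)
  comp_mem f g hf hg := by
    rw [weakEq_iff_isIso] at hf hg ⊢
    rw [𝔸.toMap.map_comp]
    infer_instance

/-- Loosely `s` is invertible, hence can be cancelled. -/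
theorem J_eq_of_comp_weakEq {x y y' : T} {f g : x ⟶ y} {s : y ⟶ y'} (hs : 𝔸.weakEq s)
    (h : f ≫ s = g ≫ s) : 𝔸.J f = 𝔸.J g := by
  have := weakEq_isInvertedBy 𝔸 s hs
  have h' := congrArg 𝔸.toMap.map h
  rw [𝔸.toMap.map_comp, 𝔸.toMap.map_comp, cancel_mono] at h'
  exact congrArg Subtype.val h'

theorem weakEq_hasRightCalculusOfFractions (hT : 𝔸.WeaklyTabular) (hA : 𝔸.HasTightCollages) :
    𝔸.weakEq.HasRightCalculusOfFractions where
  toIsMultiplicative := weakEq_isMultiplicative 𝔸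
  exists_rightFraction x y φ := by
    have := weakEq_isMultiplicative 𝔸
    have := weakEq_isInvertedBy 𝔸 _ φ.hs
    -- Writing this loose composite as a right fraction gives an Ore square that commutes only
    -- loosely; the weak equivalence `t` then corrects it to a strict one.
    let m : 𝔸.toMap.obj x ⟶ 𝔸.toMap.obj y := 𝔸.toMap.map φ.f ≫ inv (𝔸.toMap.map φ.s)
    obtain ⟨z, s, g, hs, hg⟩ := exists_fraction hT hA (x := x) (y := y) m.2
    have e : 𝔸.toMap.map g = 𝔸.toMap.map s ≫ m := Subtype.ext hg
    have e' : 𝔸.toMap.map (g ≫ φ.s) = 𝔸.toMap.map (s ≫ φ.f) := by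
      rw [𝔸.toMap.map_comp, 𝔸.toMap.map_comp, e, Category.assoc, Category.assoc,
        IsIso.inv_hom_id, Category.comp_id]
    obtain ⟨z', t, ht, h⟩ := exists_weakEq_of_J_eq hT hA _ _ (congrArg Subtype.val e')
    exact ⟨⟨t ≫ s, 𝔸.weakEq.comp_mem _ _ ht hs, t ≫ g⟩, by
      rw [Category.assoc, Category.assoc, h]⟩
  ext x y y' f₁ f₂ s hs h := by
    obtain ⟨z, t, ht, e⟩ := exists_weakEq_of_J_eq hT hA f₁ f₂ (J_eq_of_comp_weakEq hs h)
    exact ⟨z, t, ht, e⟩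

theorem lift_map_Q {x y : T} (f : x ⟶ y) :
    (Localization.Construction.lift 𝔸.toMap (weakEq_isInvertedBy 𝔸)).map (𝔸.weakEq.Q.map f) =
      𝔸.toMap.map f := by
  have := Functor.congr_hom (Localization.Construction.fac 𝔸.toMap (weakEq_isInvertedBy 𝔸)) f
  exact this.trans ((Category.id_comp _).trans (Category.comp_id _))

/-- Both the localization functor and the passage to loose maps are bijective on objects, so the
induced functor is too. With full faithfulness this makes it an isomorphism of categories, not just
an equivalence. -/
theorem lift_bijective (𝔸 : FramedAllegory.{w, u, v, v'} κ T) : Function.Bijective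
    (Localization.Construction.lift 𝔸.toMap (weakEq_isInvertedBy 𝔸)).obj := by
  have h : Function.Bijective (𝔸.toMap.obj) :=
    ⟨fun x y e => congrArg MapCat.obj e, fun x => ⟨x.obj, rfl⟩⟩
  exact (Function.Bijective.of_comp_iff _
    (Localization.Construction.objEquiv 𝔸.weakEq).bijective).1 h

theorem isIso_Q_map {x y : T} (s : x ⟶ y) (hs : 𝔸.weakEq s) : IsIso (𝔸.weakEq.Q.map s) :=
  Localization.inverts 𝔸.weakEq.Q 𝔸.weakEq s hs

theorem lift_map_surjective (hT : 𝔸.WeaklyTabular) (hA : 𝔸.HasTightCollages) {x y : T}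
    (φ : 𝔸.toMap.obj x ⟶ 𝔸.toMap.obj y) : ∃ a : 𝔸.weakEq.Q.obj x ⟶ 𝔸.weakEq.Q.obj y,
      (Localization.Construction.lift 𝔸.toMap (weakEq_isInvertedBy 𝔸)).map a = φ := by
  obtain ⟨z, s, g, hs, hg⟩ := exists_fraction hT hA (x := x) (y := y) φ.2
  have := weakEq_isInvertedBy 𝔸 _ hs
  have := isIso_Q_map s hs
  refine ⟨CategoryTheory.inv (𝔸.weakEq.Q.map s) ≫ 𝔸.weakEq.Q.map g, ?_⟩
  have e : 𝔸.toMap.map g = 𝔸.toMap.map s ≫ φ := Subtype.ext hg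
  have e' := (Localization.Construction.lift 𝔸.toMap (weakEq_isInvertedBy 𝔸)).map_comp
    (𝔸.weakEq.Q.map s) (CategoryTheory.inv (𝔸.weakEq.Q.map s) ≫ 𝔸.weakEq.Q.map g)
  rw [IsIso.hom_inv_id_assoc] at e'
  exact (cancel_epi (𝔸.toMap.map s)).1 (((congrArg (· ≫ (Localization.Construction.lift 𝔸.toMap
    (weakEq_isInvertedBy 𝔸)).map _) (lift_map_Q s)).symm.trans e'.symm).trans
      ((lift_map_Q g).trans e))

theorem lift_map_injective (hT : 𝔸.WeaklyTabular) (hA : 𝔸.HasTightCollages) {x y : T}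
    {a b : 𝔸.weakEq.Q.obj x ⟶ 𝔸.weakEq.Q.obj y}
    (hab : (Localization.Construction.lift 𝔸.toMap (weakEq_isInvertedBy 𝔸)).map a =
      (Localization.Construction.lift 𝔸.toMap (weakEq_isInvertedBy 𝔸)).map b) : a = b := by
  have := weakEq_hasRightCalculusOfFractions hT hA
  obtain ⟨ψ, hψ⟩ := Localization.exists_rightFraction 𝔸.weakEq.Q 𝔸.weakEq a
  have := isIso_Q_map _ ψ.hs
  have ha : 𝔸.weakEq.Q.map ψ.s ≫ a = 𝔸.weakEq.Q.map ψ.f := by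
    rw [hψ]
    exact ψ.map_s_comp_map _ _
  -- Taking a fraction for `ψ.s ≫ b` rather than for `b` puts `a` and `b` over the common
  -- denominator `ξ.s ≫ ψ.s`, with numerators `ξ.s ≫ ψ.f` and `ξ.f`. These are loosely equal, so a
  -- weak equivalence equalizes them.
  obtain ⟨ξ, hξ⟩ := Localization.exists_rightFraction 𝔸.weakEq.Q 𝔸.weakEq
    (𝔸.weakEq.Q.map ψ.s ≫ b)
  have := isIso_Q_map _ ξ.hs
  have hb : 𝔸.weakEq.Q.map ξ.s ≫ 𝔸.weakEq.Q.map ψ.s ≫ b = 𝔸.weakEq.Q.map ξ.f := by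
    rw [hξ]
    exact ξ.map_s_comp_map _ _
  have key : 𝔸.toMap.map (ξ.s ≫ ψ.f) = 𝔸.toMap.map ξ.f := by
    rw [← lift_map_Q, ← lift_map_Q, ← hb, Functor.map_comp, ← ha, Functor.map_comp,
      Functor.map_comp, Functor.map_comp, Functor.map_comp]
    exact congrArg (fun c => _ ≫ _ ≫ c) hab
  obtain ⟨z, t, ht, h⟩ := exists_weakEq_of_J_eq hT hA (ξ.s ≫ ψ.f) ξ.f
    (congrArg Subtype.val key)
  have := isIso_Q_map t ht
  rw [← cancel_epi (𝔸.weakEq.Q.map ψ.s), ← cancel_epi (𝔸.weakEq.Q.map ξ.s),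
    ← cancel_epi (𝔸.weakEq.Q.map t), hb, ha, ← Functor.map_comp, ← Functor.map_comp, h,
    Functor.map_comp]

theorem lift_full (hT : 𝔸.WeaklyTabular) (hA : 𝔸.HasTightCollages) :
    (Localization.Construction.lift 𝔸.toMap (weakEq_isInvertedBy 𝔸)).Full where
  map_surjective {X Y} φ := by
    obtain ⟨x, rfl⟩ := (Localization.Construction.objEquiv 𝔸.weakEq).surjective X
    obtain ⟨y, rfl⟩ := (Localization.Construction.objEquiv 𝔸.weakEq).surjective Y
    exact lift_map_surjective hT hA φ

theorem lift_faithful (hT : 𝔸.WeaklyTabular) (hA : 𝔸.HasTightCollages) :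
    (Localization.Construction.lift 𝔸.toMap (weakEq_isInvertedBy 𝔸)).Faithful where
  map_injective {X Y} a b hab := by
    obtain ⟨x, rfl⟩ := (Localization.Construction.objEquiv 𝔸.weakEq).surjective X
    obtain ⟨y, rfl⟩ := (Localization.Construction.objEquiv 𝔸.weakEq).surjective Y
    exact lift_map_injective hT hA hab

end FramedAllegory

end ExactCompletion

namespace ExactCompletion

open Allegory WeakTopology

/-! ### Refining a covering family by covers of its sources. -/

section Sigma

variable {κ : ArityClass.{w}} {C : Type u} [Category.{v} C]

theorem FunArr.comp_assoc {X Y Z W : Fam κ C} (F : FunArr X Y) (G : FunArr Y Z)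
    (H : FunArr Z W) : (F.comp G).comp H = F.comp (G.comp H) := by
  simp only [FunArr.comp, Category.assoc]

/-- The sources of a family of cocones over the members of `V`. -/
def Fam.sigma (V : Fam κ C) (Q : ∀ v, Sink.{w} C (V.obj v)) (hQ : ∀ v, κ.IsSmall (Q v).ι) :
    Fam κ C :=
  ⟨Σ v, (Q v).ι, ArityClass.isSmall_sigma V.small hQ, fun k => (Q k.1).obj k.2⟩

/-- A family of cocones over the members of `V`, as a functional array. -/
def FunArr.ofSinks (V : Fam κ C) (Q : ∀ v, Sink.{w} C (V.obj v)) (hQ : ∀ v, κ.IsSmall (Q v).ι) :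
    FunArr (V.sigma Q hQ) V :=
  ⟨fun k => k.1, fun k => (Q k.1).map k.2⟩

/-- Test the identities on `P`, and each resulting inequality on the cover `Q v`. -/
theorem FramedAllegory.IsCovering.ofSinks_comp {𝔸 : FramedAllegory.{w, u, v, v'} κ C}
    {V X : Fam κ C} {P : FunArr V X} (hP : 𝔸.IsCovering P) {Q : ∀ v, Sink.{w} C (V.obj v)}
    (hQ : ∀ v, 𝔸.Covers (Q v)) :
    𝔸.IsCovering ((FunArr.ofSinks V Q fun v => (hQ v).1).comp P) := by
  refine isCovering_iff.2 fun R hR =>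
    hP.le_of (φ := fun x => 𝔸.id (X.obj x)) (ψ := R) fun v => (hQ v).le_of fun q => ?_
  have h : 𝔸.J ((Q v).map q ≫ P.hom v) ≤
      𝔸.comp (𝔸.J ((Q v).map q ≫ P.hom v)) (R (P.toFun v)) := inv_J_comp_le_iff.1 (hR ⟨v, q⟩)
  rw [𝔸.comp_id]
  rwa [𝔸.J_comp, 𝔸.assoc] at h

end Sigma

/-! ### From the framed allegory of relations back to the site. -/

variable {κ : ArityClass.{w}} {C : Type u} [Category.{v} C] {S : Topology κ C}

/-- Each graph is a local equation, and the two can be made to hold on one covering by pulling the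
second back along the first. So `f°g` is the class of the single span `{f, g}`, which is what links
tabulations to arrays. -/
theorem RelMor.mem_inv_graph_comp_graph {x y p t : C} (f : p ⟶ x) (g : p ⟶ y) (a : t ⟶ x)
    (b : t ⟶ y) :
    ((RelMor.mk (SpanArr.graph f) : RelMor S p x).inv.comp (RelMor.mk (SpanArr.graph g))).Mem a b ↔
      S.Locally t fun s r => ∃ c : s ⟶ p, c ≫ f = r ≫ a ∧ c ≫ g = r ≫ b := by
  simp only [RelMor.mem_comp, RelMor.mem_inv, RelMor.mem_graph]
  constructor
  · intro h
    refine Locally.bind (h.mono ?_)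
    rintro s r ⟨c, h₁, h₂⟩
    refine Locally.bind (h₁.mono fun s' r' e₁ => ?_)
    refine (h₂.pullback (fun s s' r r' e => by simp [e]) r').mono fun s'' r'' e₂ => ?_
    exact ⟨r'' ≫ r' ≫ c, by simp [e₁], by simpa using e₂⟩
  · intro h
    refine h.mono ?_
    rintro s r ⟨c, h₁, h₂⟩
    exact ⟨c, Locally.pure (by simp [h₁]), Locally.pure (by simp [h₂])⟩

/-- Evaluating `1 ≤ ⋁ P°P` at the generic pair `(1, 1)` produces a covering family of `u` that
factors through `P`; saturation of the topology finishes. -/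
theorem covers_of_siteRel_covers {u : C} {P : Sink.{w} C u} (h : (SiteRel S).Covers P) :
    S.Covers P := by
  obtain ⟨hs, H⟩ := FramedAllegory.covers_iff.1 h
  have H := RelMor.le_iff.1 H (𝟙 u) (𝟙 u) ((RelMor.mem_diag _ _).2 (Locally.pure rfl))
  have K : S.Locally u fun s r => ∃ (i : P.ι) (c : s ⟶ P.obj i), c ≫ P.map i = r := by
    refine Locally.bind (((RelMor.mem_join hs _ _ _).1 H).mono ?_)
    rintro s r ⟨i, hi⟩
    refine ((RelMor.mem_inv_graph_comp_graph _ _ _ _).1 hi).mono ?_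
    rintro s' r' ⟨c, e, -⟩
    exact ⟨i, c, by simpa using e⟩
  obtain ⟨Q, hQ, hQP⟩ := K
  exact S.saturated hQ hs hQP

theorem siteRel_isCovering_iff {V U : Fam κ C} {P : FunArr V U} :
    (SiteRel S).IsCovering P ↔ S.IsCovering P :=
  ⟨fun h i => covers_of_siteRel_covers (h i), fun h i => siteRel_covers (h i)⟩

theorem siteRel_weaklyTabular (S : Topology κ C) : (SiteRel S).WeaklyTabular where
  exists_tabulation {x y} φ := by
    obtain ⟨P, rfl⟩ : ∃ P : SpanArr κ x y, (RelMor.mk P : RelMor S x y) = φ :=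
      
      RelMor.ind (p := fun φ => ∃ P, RelMor.mk P = φ) (fun P => ⟨P, rfl⟩) φ
    -- An array is the join of its spans, each being `(fst)° snd`, so its own legs tabulate it.
    refine ⟨P.dom, P.snd, P.fst, RelMor.ext_mem fun t a b => ?_⟩
    refine Iff.trans ?_ (RelMor.mem_join P.dom.small (fun i => (RelMor.mk (SpanArr.graph
      (P.fst i)) : RelMor S _ x).inv.comp (RelMor.mk (SpanArr.graph (P.snd i)))) a b).symm
    constructor
    · intro h
      refine Locally.mono (show S.Mem P a b from h) ?_
      rintro s r ⟨i, c, h₁, h₂⟩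
      exact ⟨i, (RelMor.mem_inv_graph_comp_graph _ _ _ _).2
        (Locally.pure ⟨c, by simpa using h₁, by simpa using h₂⟩)⟩
    · intro h
      refine RelMor.Mem.of_locally (h.mono ?_)
      rintro s r ⟨i, hi⟩
      refine (RelMor.mem_mk P _ _).2
        (((RelMor.mem_inv_graph_comp_graph _ _ _ _).1 hi).mono ?_)
      rintro s' r' ⟨c, h₁, h₂⟩
      exact ⟨i, c, h₁, h₂⟩
  exists_cover {x y} f g h := by
    -- The pair `(1, f)` lies in the graph of `f`, hence in that of `g`; unfolded, this says that
    -- `f` and `g` agree on a cover.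
    have H : (RelMor.mk (SpanArr.graph f) : RelMor S x y).Mem (𝟙 x) f :=
      (RelMor.mem_graph _ _ _).2 (Locally.pure (by simp))
    have h : (RelMor.mk (SpanArr.graph f) : RelMor S x y) = RelMor.mk (SpanArr.graph g) := h
    rw [h] at H
    obtain ⟨P, hP, e⟩ := (RelMor.mem_graph _ _ _).1 H
    exact ⟨P, siteRel_covers hP, fun i => by simpa using (e i).symm⟩

theorem SiteCongruence.toRel_surjective (S : Topology κ C) (X : Fam κ C) :
    Function.Surjective
      (SiteCongruence.toRel : SiteCongruence S X → (SiteRel S).Congruence X) := by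
  rintro ⟨arr, hr, hs, ht⟩
  have h : ∀ i j, ∃ P : SpanArr κ (X.obj i) (X.obj j),
      (RelMor.mk P : RelMor S (X.obj i) (X.obj j)) = arr i j :=
    fun i j =>
      RelMor.ind (p := fun φ => ∃ P, RelMor.mk P = φ) (fun P => ⟨P, rfl⟩) (arr i j)
  choose P hP using h
  -- Once the entries are literally classes, the three laws are definitionally the local refinements
  -- required of the representatives.
  obtain rfl : (fun i j => RelMor.mk (P i j)) = arr := funext fun i => funext fun j => hP i j
  exact ⟨⟨P, hr, hs, ht⟩, rfl⟩

theorem SiteCongruence.toRel_eq_iff {X : Fam κ C} (Φ Φ' : SiteCongruence S X) :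
    Φ.toRel = Φ'.toRel ↔ Φ.LocRefines Φ' ∧ Φ'.LocRefines Φ := by
  constructor
  · intro h
    have h' : ∀ i j, (RelMor.mk (Φ.arr i j) : RelMor S _ _) = RelMor.mk (Φ'.arr i j) :=
      fun i j => congrArg (fun Θ : (SiteRel S).Congruence X => Θ.arr i j) h
    exact ⟨fun i j => (RelMor.mk_eq_iff.1 (h' i j)).1, fun i j => (RelMor.mk_eq_iff.1 (h' i j)).2⟩
  · rintro ⟨h, h'⟩
    unfold SiteCongruence.toRel
    congr 1
    exact funext fun i => funext fun j => RelMor.mk_eq_iff.2 ⟨h i j, h' i j⟩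

/-! ### Spans in the site and morphisms of the exact completion. -/

namespace SiteSpan

variable {X Y : Fam κ C} {Φ : SiteCongruence S X} {Ψ : SiteCongruence S Y}

theorem isIso_left (s : SiteSpan Φ Ψ) : IsIso s.left := s.toAna.isIso_left

/-- The allegory supplies a span. Its covering condition is the one of the site, and its inequality
is the local refinement, since `P^*Φ` and `P^•ΦP_•` have the same local members. -/
theorem exists_represents (m : Φ.toEx ⟶ Ψ.toEx) : ∃ s : SiteSpan Φ Ψ, s.Represents m := by
  obtain ⟨s, hs⟩ := FramedAllegory.Ana.exists_represents (siteRel_weaklyTabular S) m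
  refine ⟨⟨s.apex, s.P, s.F, siteRel_isCovering_iff.1 s.isCovering, fun i j => ?_⟩, hs⟩
  refine locRefines_iff.2 fun t a b h => (mem_pullArr _ _ _ _ _ _).2 ?_
  have h := (mem_pullArr _ _ _ _ _ _).1 h
  exact (siteRel_mem_pullbackCong s.F Ψ.toRel i j a b).1 (RelMor.le_iff.1 (s.le i j) a b
    ((siteRel_mem_pullbackCong s.P Φ.toRel i j a b).2 h))

/-- The allegory condition yields factorizations through `Ψ` only after covering each member of `U`;
replacing `U` by those covers makes them strict. The two conditions also list the spans in opposite
orders, hence the appeals to symmetry of `Ψ`. -/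
theorem toAna_rel_iff {s s' : SiteSpan Φ Ψ} : s.toAna.Rel s'.toAna ↔ s.Rel s' := by
  constructor
  · rintro ⟨U, H, K, e, hH, hΨ⟩
    -- The inequality is evaluated at the generic member of `(F'S')° (FS)`, given by the identity of
    -- the `u`-th object.
    have hm : ∀ u, S.Mem (Ψ.arr ((H.comp s.F).toFun u) ((K.comp s'.F).toFun u))
        ((H.comp s.F).hom u) ((K.comp s'.F).hom u) := fun u =>
      Ψ.mem_symm (RelMor.le_iff.1 (hΨ u) _ _ ((RelMor.mem_inv_graph_comp_graph _ _ _ _).2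
        (Locally.pure ⟨𝟙 _, rfl, rfl⟩)))
    choose Q hQ hf using hm
    refine ⟨U.sigma Q fun u => S.small (hQ u), _,
      (FunArr.ofSinks U Q fun u => S.small (hQ u)).comp H,
      (FunArr.ofSinks U Q fun u => S.small (hQ u)).comp K,
      siteRel_isCovering_iff.1 (hH.ofSinks_comp fun u => siteRel_covers (hQ u)),
      (FunArr.comp_assoc _ _ _).symm,
      (congrArg (FunArr.comp _) e).trans (FunArr.comp_assoc _ _ _).symm, fun k => ?_⟩
    obtain ⟨i, g, h₁, h₂⟩ := hf k.1 k.2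
    exact ⟨i, g, h₁.trans (Category.assoc _ _ _).symm, h₂.trans (Category.assoc _ _ _).symm⟩
  · rintro ⟨U, R, H, K, hR, e, e', hf⟩
    refine ⟨U, H, K, e.symm.trans e', ?_, fun u => RelMor.le_iff.2 fun t a b h => ?_⟩
    · refine siteRel_isCovering_iff.2 ?_
      rw [e] at hR
      exact hR
    · refine RelMor.Mem.of_locally (((RelMor.mem_inv_graph_comp_graph _ _ _ _).1 h).mono ?_)
      rintro r p ⟨c, h₁, h₂⟩
      have h := Ψ.mem_symm (Mem.of_factors (S := S.toWeakTopology) (hf u))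
      have h := h.precomp c
      rw [← h₁, ← h₂]
      exact h

theorem eq_iff_rel {s s' : SiteSpan Φ Ψ} {m m' : Φ.toEx ⟶ Ψ.toEx} (h : s.Represents m)
    (h' : s'.Represents m') : m = m' ↔ s.Rel s' :=
  (FramedAllegory.Ana.eq_iff_rel (siteRel_weaklyTabular S) (s := s.toAna) (s' := s'.toAna)
    h h').trans toAna_rel_iff

end SiteSpan

end ExactCompletion

theorem mainTheorem7 (κ : ArityClass.{w}) :
    -- weak equivalences of tight maps: calculus of right fractions, localization
    (∀ (T : Type u) [Category.{v} T] (𝔸 : FramedAllegory.{w, u, v, v'} κ T),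
      𝔸.WeaklyTabular → 𝔸.HasTightCollages →
        𝔸.weakEq.HasRightCalculusOfFractions ∧
        ∃ h : 𝔸.weakEq.IsInvertedBy 𝔸.toMap,
          (Localization.Construction.lift 𝔸.toMap h).Full ∧
          (Localization.Construction.lift 𝔸.toMap h).Faithful ∧
          Function.Bijective (Localization.Construction.lift 𝔸.toMap h).obj) ∧
    -- loose maps of congruences in a framed allegory
    (∀ (T : Type u) [Category.{v} T] (𝔸 : FramedAllegory.{w, u, v, v'} κ T),
      𝔸.WeaklyTabular → ∀ Φ Θ : 𝔸.ModObj,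
        (∀ s : FramedAllegory.Ana Φ Θ, IsIso s.left) ∧
        (∀ m : (⟨Φ⟩ : 𝔸.Mod.MapCat) ⟶ ⟨Θ⟩, ∃ s : FramedAllegory.Ana Φ Θ, s.Represents m) ∧
        (∀ (s s' : FramedAllegory.Ana Φ Θ) (m m' : (⟨Φ⟩ : 𝔸.Mod.MapCat) ⟶ ⟨Θ⟩),
          s.Represents m → s'.Represents m' → (m = m' ↔ s.Rel s'))) ∧
    -- the exact completion of a site
    (∀ (C : Type u) [Category.{v} C] (S : Topology κ C),
      (∀ X : Fam κ C,
        Function.Surjective (SiteCongruence.toRel : SiteCongruence S X → (SiteRel S).Congruence X) ∧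
        ∀ Φ Φ' : SiteCongruence S X,
          Φ.toRel = Φ'.toRel ↔ Φ.LocRefines Φ' ∧ Φ'.LocRefines Φ) ∧
      ∀ (X Y : Fam κ C) (Φ : SiteCongruence S X) (Ψ : SiteCongruence S Y),
        (∀ s : SiteSpan Φ Ψ, IsIso s.left) ∧
        (∀ m : Φ.toEx ⟶ Ψ.toEx, ∃ s : SiteSpan Φ Ψ, s.Represents m) ∧
        (∀ (s s' : SiteSpan Φ Ψ) (m m' : Φ.toEx ⟶ Ψ.toEx),
          s.Represents m → s'.Represents m' → (m = m' ↔ s.Rel s'))) := by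

  refine ⟨fun T _ 𝔸 hT hA => ⟨FramedAllegory.weakEq_hasRightCalculusOfFractions hT hA,
    FramedAllegory.weakEq_isInvertedBy 𝔸, FramedAllegory.lift_full hT hA,
    FramedAllegory.lift_faithful hT hA, FramedAllegory.lift_bijective 𝔸⟩,
    fun T _ 𝔸 hT Φ Θ => ⟨fun s => s.isIso_left, fun m =>
      FramedAllegory.Ana.exists_represents hT m, fun s s' m m' h h' =>
        FramedAllegory.Ana.eq_iff_rel hT h h'⟩,
    fun C _ S => ⟨fun X => ⟨SiteCongruence.toRel_surjective S X, SiteCongruence.toRel_eq_iff⟩,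
      fun X Y Φ Ψ => ⟨fun s => s.isIso_left, fun m => SiteSpan.exists_represents m,
        fun s s' m m' h h' => SiteSpan.eq_iff_rel h h'⟩⟩⟩
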